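/- **Setting.** Let $k\ge 0$ be an integer, write $\dagger$ for the adjoint of a complex $k\times k$ matrix, and let $d\mu=A\,d\mu_t$ be a normalized positive $k\times k$ matrix-valued measure on the unit circle $\partial\mathbb D$: $\mu_t$ is a finite positive scalar measure, $A$ is measurable, $A\ge 0$ and $\operatorname{Tr}A=1$ $\mu_t$-a.e., and $\int A\,d\mu_t=\mathbf 1$. For functions $f,g:\partial\mathbb D\to\mathbb C^{k\times k}$ put $$\langle\!\langle f,g\rangle\!\rangle_{R}=\int f^\dagger A\,g\,d\mu_t,\qquad \langle\!\langle f,g\rangle\!\rangle_{L}=\int g\,A f^\dagger\,d\mu_t .$$ Assume $\mu$ is nontrivial: for every $n$ and $B_0,\dots,B_{n-1}\in\mathbb C^{k\times k}$, if $f=\sum_{\ell<n}B_\ell z^\ell$ satisfies $\int\operatorname{Tr}(f^\dagger A f)\,d\mu_t=0$, then all $B_\ell=0$. For a polynomial $P$ of degree at most $n$ with matrix coefficients, let $P^*(z)=z^nP(1/\bar z)^\dagger$ (with $n$ the index of $\varphi_n$ when applied to $\varphi_n$). For $\alpha\in\mathbb C^{k\times k}$ with $\|\alpha\|<1$ put $\rho^L=(1-\alpha^\dagger\alpha)^{1/2}$,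 $\rho^R=(1-\alpha\alpha^\dagger)^{1/2}$ and $$\Theta(\alpha)=\begin{pmatrix}\alpha^\dagger&\rho^L\\ \rho^R&-\alpha\end{pmatrix}.$$ **Theorem 4.2** (with Proposition 4.1). 1. There are a unique sequence $(\varphi^L_n)_{n\ge0}$ and a unique sequence $(\varphi^R_n)_{n\ge 0}$ of matrix polynomials $\varphi_n^{L}=\kappa^{L}_nz^n+\text{lower order}$, $\varphi_n^{R}=\kappa^{R}_nz^n+\text{lower order}$ with $\langle\!\langle\varphi^L_n,\varphi^L_m\rangle\!\rangle_L=\delta_{nm}\mathbf 1$, $\langle\!\langle\varphi^R_n,\varphi^R_m\rangle\!\rangle_R=\delta_{nm}\mathbf 1$, $\kappa^L_0=\kappa^R_0=\mathbf 1$, $\kappa^L_{n+1}(\kappa^L_n)^{-1}>0$, $(\kappa^R_n)^{-1}\kappa^R_{n+1}>0$. There is a unique sequence $(\alpha_n)_{n\ge0}$ of $k\times k$ matrices (the Verblunsky coefficients) with $\|\alpha_n\|<1$ such that for all $n$, with $\rho_n^L,\rho_n^R$ formed from $\alpha_n$, $$z\varphi^L_n=\rho^L_n\varphi^L_{n+1}+\alpha_n^\dagger(\varphi^R_n)^*,\qquad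 z\varphi^R_n=\varphi^R_{n+1}\rho^R_n+(\varphi^L_n)^*\alpha_n^\dagger,$$ $$(\varphi^L_n)^*=(\varphi^L_{n+1})^*\rho^L_n+z\varphi^R_n\alpha_n,\qquad (\varphi^R_n)^*=\rho^R_n(\varphi^R_{n+1})^*+\alpha_nz\varphi^L_n .$$ 2. Define the left-handed CMV and alternate CMV functions by $$\chi_{2m}=z^{-m}(\varphi^R_{2m})^*,\quad \chi_{2m-1}=z^{-m+1}\varphi^L_{2m-1},\quad x_{2m}=z^{-m}\varphi^L_{2m},\quad x_{2m-1}=z^{-m}(\varphi^R_{2m-1})^*,$$ and the right-handed ones $\tilde\chi_\ell,\tilde x_\ell$ by the same formulas with $L$ and $R$ interchanged. Then, for all $\ell,m\ge 0$, $$\langle\!\langle\chi_\ell,\chi_m\rangle\!\rangle_L=\langle\!\langle x_\ell,x_m\rangle\!\rangle_L=\langle\!\langle\tilde\chi_\ell,\tilde\chi_m\rangle\!\rangle_R=\langle\!\langle\tilde x_\ell,\tilde x_m\rangle\!\rangle_R=\delta_{\ell m}\mathbf 1 .$$ Moreover $\chi_\ell$ and $\tilde\chi_\ell$ are combinations, with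 constant $k\times k$ matrix coefficients, of the first $\ell+1$ of $1,z,z^{-1},z^2,z^{-2},\dots$, and $x_\ell$ and $\tilde x_\ell$ of the first $\ell+1$ of $1,z^{-1},z,z^{-2},z^2,\dots$. 3. Each $\Theta(\alpha_n)$ is a unitary $2k\times 2k$ matrix. Define semi-infinite matrices of $k\times k$ blocks by $$\mathcal C_{j\ell}=\langle\!\langle\tilde\chi_j,z\tilde\chi_\ell\rangle\!\rangle_R,\qquad \mathcal L_{j\ell}=\langle\!\langle\tilde\chi_j,z\tilde x_\ell\rangle\!\rangle_R,\qquad \mathcal M_{j\ell}=\langle\!\langle\tilde x_j,\tilde\chi_\ell\rangle\!\rangle_R\qquad(j,\ell\ge0).$$ Then $\mathcal C=\mathcal L\mathcal M$, that is $\mathcal C_{j\ell}=\sum_m\mathcal L_{jm}\mathcal M_{m\ell}$ with only finitely many nonzero terms, and $$\mathcal M=\mathbf 1\oplus\Theta_1(\alpha_1)\oplus\Theta_3(\alpha_3)\oplus\cdots,\qquad \mathcal L=\Theta_0(\alpha_0)\oplus\Theta_2(\alpha_2)\oplus\Theta_4(\alpha_4)\oplus\cdots,$$ where $\Theta_j(\alpha_j)=\Theta(\alpha_j)$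 placed in block rows and columns $j,j+1$, and $\mathbf 1$ is the $k\times k$ identity in block position $(0,0)$. 4. The left-handed functions give the same factors once block rows and columns are exchanged (left-module coordinates are row vectors): for all $j,\ell$, $$\langle\!\langle\chi_\ell,zx_j\rangle\!\rangle_L=\mathcal L_{j\ell},\qquad \langle\!\langle x_\ell,\chi_j\rangle\!\rangle_L=\mathcal M_{j\ell},$$ $$\langle\!\langle x_\ell,zx_j\rangle\!\rangle_L=(\mathcal L\mathcal M)_{j\ell},\qquad \langle\!\langle\chi_\ell,z\chi_j\rangle\!\rangle_L=(\mathcal M\mathcal L)_{j\ell},$$ again with only finitely many nonzero terms in each block of the products. -/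

import Mathlib

open MeasureTheory Polynomial
open scoped ComplexOrder MatrixOrder

noncomputable section

namespace MatrixCMV

instance instMeasurableSpaceCircle : MeasurableSpace Circle := borel Circle

instance instBorelSpaceCircle : BorelSpace Circle := ⟨rfl⟩

/-- The `k × k` complex matrices. -/
abbrev Mat (k : ℕ) : Type := Matrix (Fin k) (Fin k) ℂ

/-- A normalized positive `k × k` matrix-valued measure `dμ = A dμ_t` on the unit circle: a finite
positive scalar measure `μ_t` and a measurable density `A` with `A ≥ 0`, `Tr A = 1` almost
everywhere and `∫ A dμ_t = 1`. -/
structure MatrixMeasure (k : ℕ) where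
  scalar : Measure Circle
  finite : IsFiniteMeasure scalar
  density : Circle → Mat k
  aemeasurable : ∀ i j, AEMeasurable (fun z => density z i j) scalar
  posSemidef : ∀ᵐ z ∂scalar, (density z).PosSemidef
  trace_eq_one : ∀ᵐ z ∂scalar, (density z).trace = 1
  normalized : ∀ i j, ∫ z, density z i j ∂scalar = (1 : Mat k) i j

attribute [instance] MatrixMeasure.finite

variable {k : ℕ}

/-- `⟨⟨f, g⟩⟩_R = ∫ f† dμ g`, a `k × k` matrix, integrated entry by entry. -/
def innerR (μ : MatrixMeasure k) (f g : Circle → Mat k) : Mat k :=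
  Matrix.of fun i j => ∫ z, ((f z).conjTranspose * μ.density z * g z) i j ∂μ.scalar

/-- `⟨⟨f, g⟩⟩_L = ∫ g dμ f†`, a `k × k` matrix, integrated entry by entry. -/
def innerL (μ : MatrixMeasure k) (f g : Circle → Mat k) : Mat k :=
  Matrix.of fun i j => ∫ z, (g z * μ.density z * (f z).conjTranspose) i j ∂μ.scalar

/-- Nontriviality: if `f = ∑_{ℓ < n} B_ℓ z^ℓ` vanishes in `H_R`, that is
`∫ Tr (f† A f) dμ_t = 0`, then all the `B_ℓ` vanish. -/
def MatrixMeasure.Nontrivial (μ : MatrixMeasure k) : Prop :=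
  ∀ (n : ℕ) (B : Fin n → Mat k),
    (innerR μ (fun z => ∑ l : Fin n, (z : ℂ) ^ (l : ℕ) • B l)
      (fun z => ∑ l : Fin n, (z : ℂ) ^ (l : ℕ) • B l)).trace = 0 → ∀ l, B l = 0

/-- The value `∑ c_j z^j` on the circle of a polynomial `∑ c_j X^j` with matrix coefficients. -/
def evalCircle (P : (Mat k)[X]) (z : Circle) : Mat k :=
  P.sum fun j c => (z : ℂ) ^ j • c

/-- The Szegő dual `P^*(z) = z^n P(1 / z̄)†` of a polynomial of degree at most `n`, that is
`∑_{j ≤ n} c_{n-j}† X^j` for `P = ∑_{j ≤ n} c_j X^j`. -/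
def szegoDual (n : ℕ) (P : (Mat k)[X]) : (Mat k)[X] :=
  ∑ j ∈ Finset.range (n + 1), monomial j (P.coeff (n - j)).conjTranspose

/-- The normalized left orthogonal polynomials: `φ_n = κ_n z^n + lower order`,
`⟨⟨φ_n, φ_m⟩⟩_L = δ_{nm} 1`, with `κ_0 = 1` and `κ_{n+1} κ_n⁻¹ > 0`. -/
structure IsLeftOPUC (μ : MatrixMeasure k) (φ : ℕ → (Mat k)[X]) : Prop where
  natDegree_le : ∀ n, (φ n).natDegree ≤ n
  orthonormal : ∀ n m,
    innerL μ (evalCircle (φ n)) (evalCircle (φ m)) = if n = m then 1 else 0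
  leading_zero : (φ 0).coeff 0 = 1
  leading_succ : ∀ n, ((φ (n + 1)).coeff (n + 1) * ((φ n).coeff n)⁻¹).PosDef

/-- The normalized right orthogonal polynomials: `φ_n = κ_n z^n + lower order`,
`⟨⟨φ_n, φ_m⟩⟩_R = δ_{nm} 1`, with `κ_0 = 1` and `κ_n⁻¹ κ_{n+1} > 0`. -/
structure IsRightOPUC (μ : MatrixMeasure k) (φ : ℕ → (Mat k)[X]) : Prop where
  natDegree_le : ∀ n, (φ n).natDegree ≤ n
  orthonormal : ∀ n m,
    innerR μ (evalCircle (φ n)) (evalCircle (φ m)) = if n = m then 1 else 0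
  leading_zero : (φ 0).coeff 0 = 1
  leading_succ : ∀ n, (((φ n).coeff n)⁻¹ * (φ (n + 1)).coeff (n + 1)).PosDef

/-- `ρ^L = (1 - α† α)^{1/2}`. -/
def rhoL (α : Mat k) : Mat k := CFC.sqrt (1 - α.conjTranspose * α)

/-- `ρ^R = (1 - α α†)^{1/2}`. -/
def rhoR (α : Mat k) : Mat k := CFC.sqrt (1 - α * α.conjTranspose)

/-- `α` is the sequence of Verblunsky coefficients attached to `φ^L`, `φ^R`: every `α_n` has
operator norm less than one, and the four Szegő recursion relations hold. -/
structure IsVerblunsky (φL φR : ℕ → (Mat k)[X]) (α : ℕ → Mat k) : Prop where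
  norm_lt_one : ∀ n, ‖Matrix.toEuclideanCLM (n := Fin k) (𝕜 := ℂ) (α n)‖ < 1
  left : ∀ n, X * φL n =
    C (rhoL (α n)) * φL (n + 1) + C (α n).conjTranspose * szegoDual n (φR n)
  right : ∀ n, X * φR n =
    φR (n + 1) * C (rhoR (α n)) + szegoDual n (φL n) * C (α n).conjTranspose
  left_dual : ∀ n, szegoDual n (φL n) =
    szegoDual (n + 1) (φL (n + 1)) * C (rhoL (α n)) + X * φR n * C (α n)
  right_dual : ∀ n, szegoDual n (φR n) =
    C (rhoR (α n)) * szegoDual (n + 1) (φR (n + 1)) + C (α n) * (X * φL n)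

/-- The CMV functions built from two sequences of polynomials:
`χ_{2m} = z^{-m} (ψ_{2m})^*` and `χ_{2m-1} = z^{-m+1} φ_{2m-1}`.
In both cases the exponent of `z` is `-⌊ℓ/2⌋`. -/
def cmvChi (φ ψ : ℕ → (Mat k)[X]) (l : ℕ) (z : Circle) : Mat k :=
  (z : ℂ) ^ (-((l / 2 : ℕ) : ℤ)) •
    (if Even l then evalCircle (szegoDual l (ψ l)) z else evalCircle (φ l) z)

/-- The alternate CMV functions built from two sequences of polynomials:
`x_{2m} = z^{-m} φ_{2m}` and `x_{2m-1} = z^{-m} (ψ_{2m-1})^*`.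
In both cases the exponent of `z` is `-⌊(ℓ+1)/2⌋`. -/
def cmvX (φ ψ : ℕ → (Mat k)[X]) (l : ℕ) (z : Circle) : Mat k :=
  (z : ℂ) ^ (-(((l + 1) / 2 : ℕ) : ℤ)) •
    (if Even l then evalCircle (φ l) z else evalCircle (szegoDual l (ψ l)) z)

/-- Multiplication of a matrix-valued function by `z`. -/
def mulZ (f : Circle → Mat k) (z : Circle) : Mat k := (z : ℂ) • f z

/-- The exponents `0, 1, -1, 2, -2, …` of the sequence `1, z, z⁻¹, z², z⁻², …`. -/
def cmvExponent (j : ℕ) : ℤ := if Even j then -((j / 2 : ℕ) : ℤ) else ((j + 1) / 2 : ℕ)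

/-- `f` lies in the module span of `z^{e_0}, …, z^{e_{n-1}}`: `f = ∑_{j < n} B_j z^{e_j}` with
constant matrices `B_j`. -/
def InModuleSpan (e : ℕ → ℤ) (n : ℕ) (f : Circle → Mat k) : Prop :=
  ∃ B : Fin n → Mat k, ∀ z : Circle, f z = ∑ j : Fin n, (z : ℂ) ^ e j • B j

/-- `Θ(α)` as a `2 × 2` matrix of `k × k` blocks. -/
def theta (α : Mat k) : Matrix (Fin 2) (Fin 2) (Mat k) :=
  !![α.conjTranspose, rhoL α; rhoR α, -α]

/-- `Θ(α)` as a `2k × 2k` complex matrix. -/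
def thetaFull (α : Mat k) : Matrix (Fin 2 × Fin k) (Fin 2 × Fin k) ℂ :=
  Matrix.comp (Fin 2) (Fin 2) (Fin k) (Fin k) ℂ (theta α)

/-- The semi-infinite block matrix `T_0 ⊕ T_1 ⊕ T_2 ⊕ ⋯`, where `T_i` occupies the block rows and
columns `2i, 2i+1`. -/
def directSum (T : ℕ → Matrix (Fin 2) (Fin 2) (Mat k)) : Matrix ℕ ℕ (Mat k) :=
  Matrix.of fun j l =>
    if j / 2 = l / 2 then T (j / 2) (Fin.ofNat 2 j) (Fin.ofNat 2 l) else 0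

/-- The semi-infinite block matrix `1 ⊕ S`, with the `k × k` identity in the corner. -/
def oneDirectSum (S : Matrix ℕ ℕ (Mat k)) : Matrix ℕ ℕ (Mat k) :=
  Matrix.of fun j l =>
    match j, l with
    | 0, 0 => 1
    | j + 1, l + 1 => S j l
    | _, _ => 0

/-- `Θ_0(α_0) ⊕ Θ_2(α_2) ⊕ Θ_4(α_4) ⊕ ⋯`. -/
def blockL (α : ℕ → Mat k) : Matrix ℕ ℕ (Mat k) := directSum fun i => theta (α (2 * i))

/-- `1 ⊕ Θ_1(α_1) ⊕ Θ_3(α_3) ⊕ ⋯`. -/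
def blockM (α : ℕ → Mat k) : Matrix ℕ ℕ (Mat k) :=
  oneDirectSum (directSum fun i => theta (α (2 * i + 1)))

/-- `P` is the product `S T` of semi-infinite block matrices: `P_{jl} = ∑_m S_{jm} T_{ml}`, where
for fixed `j, l` only finitely many summands are nonzero. -/
def IsBlockProduct (P S T : Matrix ℕ ℕ (Mat k)) : Prop :=
  ∀ j l, (Function.support fun m => S j m * T m l).Finite ∧ P j l = ∑ᶠ m, S j m * T m l

/-- The block matrix `⟨⟨f_j, g_l⟩⟩_R`, `j` indexing the block rows. Since `⟨⟨·, ·⟩⟩_R` is linear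
for multiplication by constants from the right, this is the matrix, in right-module coordinates, of
the `g_l` with respect to the `f_j`. -/
def gramR (μ : MatrixMeasure k) (f g : ℕ → Circle → Mat k) : Matrix ℕ ℕ (Mat k) :=
  Matrix.of fun j l => innerR μ (f j) (g l)

/-- The block matrix `⟨⟨f_l, g_j⟩⟩_L`, `j` indexing the block rows. Since `⟨⟨·, ·⟩⟩_L` is linear
for multiplication by constants from the left, coordinates are row vectors and row `j` of this
matrix holds the coordinates of `g_j` with respect to the `f_l`. -/
def gramL (μ : MatrixMeasure k) (f g : ℕ → Circle → Mat k) : Matrix ℕ ℕ (Mat k) :=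
  Matrix.of fun j l => innerL μ (f l) (g j)

end MatrixCMV

end

noncomputable section

namespace MatrixCMV

variable {k : ℕ}

section

/-! ### Positive definite matrices -/

/-! Everything is carried out in the right module. On the circle the left product is the right
product of adjoints in reversed order (`innerL_eq_innerR`), and `(φ^L_n)^* = z^n (φ^L_n)†`. The
unknowns are therefore the pairs `f_n = φ^R_n`, `g_n = (φ^L_n)^*`: `f_n` is orthogonal to `1, …,
z^{n-1}` and `g_n` to `z, …, z^n`.

Both `z f_n` and `g_n` are orthogonal to `z, …, z^n`, so one matrix `α = ⟨⟨z f_n, g_n⟩⟩_R` controls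
the next step. The vectors `z f_n - g_n α†` and `g_n - z f_n α` have Gram matrices `1 - αα†` and `1
- α†α`. Nontriviality makes these positive definite, whence `‖α‖ < 1`, and dividing by their square
roots gives `f_{n+1}` and `g_{n+1}` (`IsSzegoPair.next`). Positivity of the square roots is the
normalization of the leading coefficients. The remaining Szegő relations are duals of these two.

For uniqueness, two orthonormal sequences differ by a right unitary factor in each degree. The
positivity conditions force that factor to be `1` (`eq_one_of_posDef_mul`). The coefficient `α_n` is
recovered by pairing the recursion with `g_n`.

By the intertwining `ρ^R α = α ρ^L`, the recursion can be solved for `z f_n` and `g_{n+1}` in terms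
of `g_n` and `f_{n+1}`, with the columns of `Θ(α_n)` as coefficients. Shifted by powers of `z`, the
even `n` expand `z x̃` in `χ̃` and the odd `n` expand `χ̃` in `x̃`. These expansions are finite and
the families orthonormal, so the Gram matrices and their products can be read off without any
completeness argument. Adjoints exchange `χ` with `x̃` and `x` with `χ̃`, which gives the
left-handed statements. -/

lemma posDef_sqrt {a : Mat k} (h : a.PosDef) : (CFC.sqrt a).PosDef := by
  rw [← Matrix.isStrictlyPositive_iff_posDef]
  have h0 : 0 ≤ a := Matrix.nonneg_iff_posSemidef.2 h.posSemidef
  exact ((CFC.isUnit_sqrt_iff a h0).2 h.isUnit).isStrictlyPositive (CFC.sqrt_nonneg a)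

lemma sqrt_mul_self_of_posDef {a : Mat k} (h : a.PosDef) : CFC.sqrt a * CFC.sqrt a = a :=
  CFC.sqrt_mul_sqrt_self a (Matrix.nonneg_iff_posSemidef.2 h.posSemidef)

lemma posDef_eq_of_mul_self_eq {a b : Mat k} (ha : a.PosDef) (hb : b.PosDef)
    (h : a * a = b * b) : a = b := by
  rw [← CFC.sqrt_unique (a := b * b) (b := a) h (Matrix.nonneg_iff_posSemidef.2 ha.posSemidef),
    CFC.sqrt_unique (a := b * b) (b := b) rfl (Matrix.nonneg_iff_posSemidef.2 hb.posSemidef)]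

/-- A unitary factor relating two positive definite matrices is trivial. -/
lemma eq_one_of_posDef_mul {p q c : Mat k} (hp : p.PosDef) (hq : q.PosDef) (h : q = p * c)
    (hc : c.conjTranspose * c = 1) : c = 1 := by
  have hc' : c * c.conjTranspose = 1 := mul_eq_one_comm.1 hc
  have hqp : q * q = p * p := by
    calc q * q = q * q.conjTranspose := by rw [hq.isHermitian.eq]
      _ = p * (c * c.conjTranspose) * p := by
        rw [h, Matrix.conjTranspose_mul, hp.isHermitian.eq]; simp only [mul_assoc]
      _ = p * p := by rw [hc', mul_one]
  have := posDef_eq_of_mul_self_eq hq hp hqp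
  rw [this] at h
  exact (hp.isUnit.mul_left_cancel (by rw [mul_one, ← h])).symm

/-- Multiplying by `Y†` on the left and taking traces gives `Tr (Y†SY) + Tr (YTY†) = 0` with both
terms nonnegative. So `Y†SY = 0`, and definiteness of `S` kills `Y`. -/
lemma sylvester_eq_zero {S T Y : Mat k} (hS : S.PosDef) (hT : T.PosDef)
    (h : S * Y + Y * T = 0) : Y = 0 := by
  have h1 : (Y.conjTranspose * S * Y).PosSemidef := hS.posSemidef.conjTranspose_mul_mul_same Y
  have h2 : (Y * T * Y.conjTranspose).PosSemidef := hT.posSemidef.mul_mul_conjTranspose_same Y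
  have h3 : (Y.conjTranspose * S * Y).trace + (Y * T * Y.conjTranspose).trace = 0 := by
    rw [Matrix.trace_mul_comm (Y * T), ← Matrix.trace_add, mul_assoc, ← mul_add, h, mul_zero,
      Matrix.trace_zero]
  have h4 := (add_eq_zero_iff_of_nonneg h1.trace_nonneg h2.trace_nonneg).1 h3
  have h5 := h1.trace_eq_zero_iff.1 h4.1
  have h6 : ∀ x, Y.mulVec x = 0 := by
    intro x
    by_contra hx
    have := hS.dotProduct_mulVec_pos hx
    rw [Matrix.star_mulVec, Matrix.dotProduct_mulVec, Matrix.vecMul_vecMul,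
      Matrix.dotProduct_mulVec, Matrix.vecMul_vecMul, h5] at this
    simp at this
  exact Matrix.ext_of_mulVec_single fun i => by rw [h6, Matrix.zero_mulVec]

/-- The condition `1 - α α† > 0`, which is equivalent to `‖α‖ < 1`, in both versions. -/
structure IsContr (α : Mat k) : Prop where
  left : (1 - α.conjTranspose * α).PosDef
  right : (1 - α * α.conjTranspose).PosDef

/-! ### Contractions, their defect square roots and the unitary block. -/

variable {α : Mat k}

lemma IsContr.rhoL_posDef (h : IsContr α) : (rhoL α).PosDef := posDef_sqrt h.left

lemma IsContr.rhoR_posDef (h : IsContr α) : (rhoR α).PosDef := posDef_sqrt h.right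

lemma IsContr.rhoL_mul_self (h : IsContr α) : rhoL α * rhoL α = 1 - α.conjTranspose * α :=
  sqrt_mul_self_of_posDef h.left

lemma IsContr.rhoR_mul_self (h : IsContr α) : rhoR α * rhoR α = 1 - α * α.conjTranspose :=
  sqrt_mul_self_of_posDef h.right

/-- The difference `Y` of the two sides satisfies `ρ^R Y + Y ρ^L = (1 - αα†)α - α(1 - α†α) = 0`, a
Sylvester equation with positive definite coefficients. -/
lemma IsContr.rhoR_mul (h : IsContr α) : rhoR α * α = α * rhoL α := by
  rw [← sub_eq_zero]
  refine sylvester_eq_zero h.rhoR_posDef h.rhoL_posDef ?_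
  rw [mul_sub, sub_mul, ← mul_assoc, mul_assoc α, h.rhoR_mul_self, h.rhoL_mul_self]
  noncomm_ring

lemma IsContr.conjTranspose_mul_rhoR (h : IsContr α) :
    α.conjTranspose * rhoR α = rhoL α * α.conjTranspose := by
  have := congrArg Matrix.conjTranspose h.rhoR_mul
  rwa [Matrix.conjTranspose_mul, Matrix.conjTranspose_mul, h.rhoR_posDef.isHermitian.eq,
    h.rhoL_posDef.isHermitian.eq] at this

section
open scoped Matrix.Norms.L2Operator

/-- If `‖α‖ ≥ 1`, then `t = ‖α†α‖ ≥ 1` lies in the spectrum of `α†α`, yet `t - α†α = (1 - α†α) + (t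
- 1)` is positive definite, hence invertible. The case `k = 0` is separate because spectra in the
zero ring are empty. -/
lemma IsContr.norm_lt_one (h : IsContr α) :
    ‖Matrix.toEuclideanCLM (n := Fin k) (𝕜 := ℂ) α‖ < 1 := by
  rw [Matrix.l2_opNorm_toEuclideanCLM]
  rcases subsingleton_or_nontrivial (Mat k) with hs | hs
  · rw [Subsingleton.elim α 0, norm_zero]; exact one_pos
  by_contra! hn
  have hn2 : 1 ≤ ‖star α * α‖ := by
    rw [CStarRing.norm_star_mul_self]; nlinarith
  have hmem := CStarAlgebra.norm_mem_spectrum_of_nonneg (a := star α * α) (star_mul_self_nonneg α)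
  rw [spectrum.mem_iff] at hmem
  apply hmem
  have : (algebraMap ℝ (Mat k) ‖star α * α‖ - star α * α) =
      (1 - α.conjTranspose * α) + (‖star α * α‖ - 1) • (1 : Mat k) := by
    rw [Algebra.algebraMap_eq_smul_one, sub_smul, one_smul, Matrix.star_eq_conjTranspose]; abel
  rw [this]
  refine (h.left.add_posSemidef ?_).isUnit
  exact Matrix.PosSemidef.one.smul (sub_nonneg.2 hn2)
end

/-- The diagonal blocks of `ΘΘ†` are the defining equations of `ρ^L` and `ρ^R`. The off-diagonal
blocks vanish by the intertwining relation and its adjoint. -/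
lemma IsContr.thetaFull_mem (h : IsContr α) :
    thetaFull α ∈ Matrix.unitaryGroup (Fin 2 × Fin k) ℂ := by
  have hL := h.rhoL_posDef.isHermitian.eq
  have hR := h.rhoR_posDef.isHermitian.eq
  have h1 : theta α * Matrix.of ![![α, rhoR α], ![rhoL α, -α.conjTranspose]] = 1 := by
    rw [theta]
    ext i j : 2
    fin_cases i <;> fin_cases j <;>
      simp [Matrix.mul_apply, Fin.sum_univ_two, h.rhoL_mul_self, h.rhoR_mul_self, h.rhoR_mul,
        h.conjTranspose_mul_rhoR]
  rw [Matrix.mem_unitaryGroup_iff]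
  have h2 : star (thetaFull α) = Matrix.comp (Fin 2) (Fin 2) (Fin k) (Fin k) ℂ
      (Matrix.of ![![α, rhoR α], ![rhoL α, -α.conjTranspose]]) := by
    ext ⟨i, a⟩ ⟨j, b⟩
    rw [Matrix.star_apply]
    fin_cases i <;> fin_cases j <;> simp [thetaFull, theta, Matrix.comp_apply]
    · exact congrFun₂ hR a b
    · exact congrFun₂ hL a b
  rw [h2, thetaFull]
  have := congrArg (Matrix.compRingEquiv (Fin 2) (Fin k) ℂ) h1
  rw [map_mul, map_one] at this
  exact this

end

section

/-! ### The matrix-valued inner product -/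

/-- Write `A = B†B`. The trace condition says that the squared moduli of the entries of `B` sum to
`1`, so an entry of `A` is a sum of `k` products of modulus at most `1`. The crude bound makes the
density integrable. -/
lemma norm_apply_le_of_posSemidef {A : Mat k} (hA : A.PosSemidef) (ht : A.trace = 1)
    (i j : Fin k) : ‖A i j‖ ≤ k := by
  obtain ⟨B, rfl⟩ := CStarAlgebra.nonneg_iff_eq_star_mul_self.1 hA.nonneg
  rw [Matrix.star_eq_conjTranspose] at *
  have hsum : ∑ b, ∑ a, ‖B a b‖ ^ 2 = (1 : ℝ) := by
    have : ((∑ b, ∑ a, ‖B a b‖ ^ 2 : ℝ) : ℂ) = 1 := by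
      rw [← ht, Matrix.trace]
      push_cast
      refine Finset.sum_congr rfl fun b _ => ?_
      rw [Matrix.diag_apply, Matrix.mul_apply]
      refine Finset.sum_congr rfl fun a _ => ?_
      rw [Matrix.conjTranspose_apply, RCLike.star_def, RCLike.conj_mul]; rfl
    exact_mod_cast this
  have hB : ∀ a b, ‖B a b‖ ≤ 1 := by
    intro a b
    have h1 : ‖B a b‖ ^ 2 ≤ ∑ a, ‖B a b‖ ^ 2 :=
      Finset.single_le_sum (f := fun a => ‖B a b‖ ^ 2) (fun _ _ => by positivity)
        (Finset.mem_univ a)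
    have h2 : ∑ a, ‖B a b‖ ^ 2 ≤ ∑ b, ∑ a, ‖B a b‖ ^ 2 :=
      Finset.single_le_sum (f := fun b => ∑ a, ‖B a b‖ ^ 2)
        (fun _ _ => by positivity) (Finset.mem_univ b)
    nlinarith [norm_nonneg (B a b)]
  rw [Matrix.mul_apply]
  calc ‖∑ a, B.conjTranspose i a * B a j‖ ≤ ∑ a, ‖B.conjTranspose i a * B a j‖ :=
        norm_sum_le _ _
    _ ≤ ∑ _a : Fin k, (1 : ℝ) := by
        refine Finset.sum_le_sum fun a _ => ?_
        rw [norm_mul, Matrix.conjTranspose_apply, norm_star]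
        exact mul_le_one₀ (hB a i) (norm_nonneg _) (hB a j)
    _ = k := by simp

variable (μ : MatrixMeasure k)

lemma integrable_density (i j : Fin k) : Integrable (fun z => μ.density z i j) μ.scalar := by
  refine Integrable.of_bound (μ.aemeasurable i j).aestronglyMeasurable k ?_
  filter_upwards [μ.posSemidef, μ.trace_eq_one] with z h1 h2
  exact norm_apply_le_of_posSemidef h1 h2 i j

lemma continuous_circle_bound {f : Circle → ℂ} (hf : Continuous f) : ∃ C, ∀ z, ‖f z‖ ≤ C := by
  obtain ⟨C, hC⟩ := isCompact_univ.exists_bound_of_continuousOn hf.continuousOn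
  exact ⟨C, fun z => hC z trivial⟩

variable {μ} {f g h : Circle → Mat k}

lemma integrable_innerR (hf : Continuous f) (hg : Continuous g) (i j : Fin k) :
    Integrable (fun z => ((f z).conjTranspose * μ.density z * g z) i j) μ.scalar := by
  simp only [Matrix.mul_apply, Matrix.conjTranspose_apply, Finset.sum_mul]
  refine integrable_finsetSum _ fun a _ => integrable_finsetSum _ fun b _ => ?_
  have hc : Continuous fun z => star (f z b i) * g z a j :=
    (hf.matrix_elem b i).star.mul (hg.matrix_elem a j)
  obtain ⟨C, hC⟩ := continuous_circle_bound hc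
  refine ((integrable_density μ b a).bdd_mul (c := C) hc.aestronglyMeasurable
    (Filter.Eventually.of_forall hC)).congr (Filter.Eventually.of_forall fun z => ?_)
  simp only; ring

lemma innerR_congr_integrand {f' g' : Circle → Mat k}
    (h : ∀ z, (f z).conjTranspose * μ.density z * g z =
      (f' z).conjTranspose * μ.density z * g' z) : innerR μ f g = innerR μ f' g' := by
  simp only [innerR, h]

/-- The bridge by which all left-handed statements become right-handed ones. -/
lemma innerL_eq_innerR (f g : Circle → Mat k) :
    innerL μ f g = innerR μ (fun z => (g z).conjTranspose) (fun z => (f z).conjTranspose) := by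
  simp only [innerL, innerR, Matrix.conjTranspose_conjTranspose]

lemma innerR_add_right (hf : Continuous f) (hg : Continuous g) (hh : Continuous h) :
    innerR μ f (fun z => g z + h z) = innerR μ f g + innerR μ f h := by
  ext i j
  simp only [innerR, Matrix.of_apply, Matrix.add_apply, mul_add]
  exact integral_add (integrable_innerR hf hg i j) (integrable_innerR hf hh i j)

lemma innerR_sub_right (hf : Continuous f) (hg : Continuous g) (hh : Continuous h) :
    innerR μ f (fun z => g z - h z) = innerR μ f g - innerR μ f h := by
  ext i j
  simp only [innerR, Matrix.of_apply, Matrix.sub_apply, mul_sub]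
  exact integral_sub (integrable_innerR hf hg i j) (integrable_innerR hf hh i j)

lemma innerR_mul_right (hf : Continuous f) (hg : Continuous g) (B : Mat k) :
    innerR μ f (fun z => g z * B) = innerR μ f g * B := by
  ext i j
  simp only [innerR, Matrix.of_apply, ← mul_assoc]
  simp only [Matrix.mul_apply (N := B), Matrix.of_apply]
  rw [integral_finsetSum _ fun a _ => (integrable_innerR hf hg i a).mul_const _]
  simp only [integral_mul_const]

lemma conjTranspose_innerR (f g : Circle → Mat k) :
    (innerR μ f g).conjTranspose = innerR μ g f := by
  ext i j
  simp only [innerR, Matrix.of_apply, Matrix.conjTranspose_apply, RCLike.star_def]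
  rw [← integral_conj]
  refine integral_congr_ae ?_
  filter_upwards [μ.posSemidef] with z hz
  rw [← RCLike.star_def, ← Matrix.conjTranspose_apply, Matrix.conjTranspose_mul,
    Matrix.conjTranspose_mul, Matrix.conjTranspose_conjTranspose, hz.isHermitian.eq, mul_assoc]

lemma innerR_sum_right {ι : Type*} (s : Finset ι) {g : ι → Circle → Mat k} (hf : Continuous f)
    (hg : ∀ i, Continuous (g i)) :
    innerR μ f (fun z => ∑ i ∈ s, g i z) = ∑ i ∈ s, innerR μ f (g i) := by
  classical
  induction s using Finset.induction_on with
  | empty =>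
    -- The zero function is written as `f` times the zero matrix.
    have := innerR_mul_right (μ := μ) hf hf 0
    simpa using this
  | insert a s ha ih =>
    simp only [Finset.sum_insert ha]
    rw [innerR_add_right hf (hg a) (continuous_finsetSum _ fun i _ => hg i), ih]

lemma innerR_mul_left (hf : Continuous f) (hg : Continuous g) (B : Mat k) :
    innerR μ (fun z => f z * B) g = B.conjTranspose * innerR μ f g := by
  rw [← conjTranspose_innerR, innerR_mul_right hg hf, Matrix.conjTranspose_mul,
    conjTranspose_innerR]

lemma innerR_sum_left {ι : Type*} (s : Finset ι) {f : ι → Circle → Mat k}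
    (hf : ∀ i, Continuous (f i)) (hg : Continuous g) :
    innerR μ (fun z => ∑ i ∈ s, f i z) g = ∑ i ∈ s, innerR μ (f i) g := by
  rw [← conjTranspose_innerR, innerR_sum_right s hg hf, Matrix.conjTranspose_sum]
  simp only [conjTranspose_innerR]

/-- On the circle the conjugate of `z` is `z⁻¹`. -/
lemma innerR_zpow_left (n : ℤ) (f g : Circle → Mat k) :
    innerR μ (fun z => (z : ℂ) ^ n • f z) g = innerR μ f (fun z => (z : ℂ) ^ (-n) • g z) := by
  refine innerR_congr_integrand fun z => ?_
  rw [Matrix.conjTranspose_smul, Matrix.smul_mul, Matrix.smul_mul, Matrix.mul_smul]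
  congr 1
  rw [RCLike.star_def, map_zpow₀, ← Circle.coe_inv_eq_conj, Circle.coe_inv, inv_zpow, zpow_neg]

lemma innerR_zpow_zpow (n : ℤ) (f g : Circle → Mat k) :
    innerR μ (fun z => (z : ℂ) ^ n • f z) (fun z => (z : ℂ) ^ n • g z) = innerR μ f g := by
  rw [innerR_zpow_left]
  refine congrArg _ (funext fun z => ?_)
  rw [smul_smul, ← zpow_add₀ (Circle.coe_ne_zero z), neg_add_cancel, zpow_zero, one_smul]

lemma innerR_self_posSemidef (hf : Continuous f) : (innerR μ f f).PosSemidef := by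
  refine Matrix.PosSemidef.of_dotProduct_mulVec_nonneg (conjTranspose_innerR f f) fun x => ?_
  have : star x ⬝ᵥ (innerR μ f f).mulVec x =
      ∫ z, star x ⬝ᵥ (((f z).conjTranspose * μ.density z * f z).mulVec x) ∂μ.scalar := by
    simp only [dotProduct, Matrix.mulVec, innerR, Matrix.of_apply]
    rw [integral_finsetSum _ fun i _ => (integrable_finsetSum _ fun j _ =>
      (integrable_innerR hf hf i j).mul_const _).const_mul _]
    refine Finset.sum_congr rfl fun i _ => ?_
    rw [integral_const_mul, integral_finsetSum _ fun j _ =>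
      (integrable_innerR hf hf i j).mul_const _]
    simp only [integral_mul_const]
  rw [this]
  refine integral_nonneg_of_ae ?_
  filter_upwards [μ.posSemidef] with z hz
  exact (hz.conjTranspose_mul_mul_same (f z)).dotProduct_mulVec_nonneg x

@[fun_prop]
lemma continuous_zpow_smul (n : ℤ) (hf : Continuous f) :
    Continuous fun z : Circle => (z : ℂ) ^ n • f z :=
  (Continuous.zpow₀ (by fun_prop) n fun z => Or.inl (Circle.coe_ne_zero z)).smul hf

end

section

/-! ### Matrix polynomials on the circle -/

/-- Evaluation at a scalar, as a ring homomorphism. -/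
def evalHom (w : ℂ) : (Mat k)[X] →+* Mat k :=
  eval₂RingHom' (RingHom.id _) (algebraMap ℂ (Mat k) w) fun a => (Algebra.commutes w a).symm

lemma evalHom_apply (P : (Mat k)[X]) (w : ℂ) : evalHom w P = P.sum fun j c => w ^ j • c := by
  change P.eval₂ (RingHom.id _) (algebraMap ℂ (Mat k) w) = _
  rw [eval₂_eq_sum]
  refine Finset.sum_congr rfl fun j _ => ?_
  simp only [RingHom.id_apply]
  rw [← map_pow, ← Algebra.commutes, Algebra.smul_def]

lemma evalCircle_eq_evalHom (P : (Mat k)[X]) (z : Circle) :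
    evalCircle P z = evalHom (z : ℂ) P := (evalHom_apply P _).symm

section eval

variable (P Q : (Mat k)[X]) (z : Circle)

lemma evalCircle_add : evalCircle (P + Q) z = evalCircle P z + evalCircle Q z := by
  simp only [evalCircle_eq_evalHom, map_add]

lemma evalCircle_sub : evalCircle (P - Q) z = evalCircle P z - evalCircle Q z := by
  simp only [evalCircle_eq_evalHom, map_sub]

lemma evalCircle_mul : evalCircle (P * Q) z = evalCircle P z * evalCircle Q z := by
  simp only [evalCircle_eq_evalHom, map_mul]

lemma evalCircle_C (B : Mat k) : evalCircle (C B) z = B := by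
  rw [evalCircle, sum_C_index] <;> simp

lemma evalCircle_X_mul : evalCircle (X * P) z = (z : ℂ) ^ (1 : ℤ) • evalCircle P z := by
  rw [evalCircle_mul, evalCircle, sum_X_index] <;> simp

end eval

lemma evalCircle_eq_sum {P : (Mat k)[X]} {n : ℕ} (h : P.natDegree ≤ n) (z : Circle) :
    evalCircle P z = ∑ j ∈ Finset.range (n + 1), (z : ℂ) ^ (j : ℤ) • P.coeff j := by
  simp only [zpow_natCast]
  exact sum_over_range' _ (by simp) _ (by omega)

@[fun_prop]
lemma continuous_evalCircle (P : (Mat k)[X]) : Continuous (evalCircle P) := by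
  have : evalCircle P = fun z : Circle => ∑ j ∈ Finset.range (P.natDegree + 1),
      (z : ℂ) ^ (j : ℤ) • P.coeff j := funext fun z => evalCircle_eq_sum le_rfl z
  rw [this]
  exact continuous_finsetSum _ fun j _ => continuous_zpow_smul _ continuous_const

lemma coeff_szegoDual (n : ℕ) (P : (Mat k)[X]) (j : ℕ) :
    (szegoDual n P).coeff j = if j ≤ n then (P.coeff (n - j)).conjTranspose else 0 := by
  simp only [szegoDual, finsetSum_coeff, coeff_monomial, Finset.sum_ite_eq', Finset.mem_range,
    Nat.lt_succ_iff]

lemma natDegree_szegoDual_le (n : ℕ) (P : (Mat k)[X]) : (szegoDual n P).natDegree ≤ n :=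
  natDegree_le_iff_coeff_eq_zero.2 fun j hj => by rw [coeff_szegoDual, if_neg (by omega)]

lemma szegoDual_szegoDual {n : ℕ} {P : (Mat k)[X]} (h : P.natDegree ≤ n) :
    szegoDual n (szegoDual n P) = P := by
  ext1 j
  rw [coeff_szegoDual]
  split_ifs with hj
  · rw [coeff_szegoDual, if_pos (by omega), Matrix.conjTranspose_conjTranspose,
      Nat.sub_sub_self hj]
  · rw [coeff_eq_zero_of_natDegree_lt (by omega)]

lemma szegoDual_add (n : ℕ) (P Q : (Mat k)[X]) :
    szegoDual n (P + Q) = szegoDual n P + szegoDual n Q := by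
  ext1 j
  simp only [coeff_szegoDual, coeff_add]
  split_ifs <;> simp [Matrix.conjTranspose_add]

lemma szegoDual_mul_C (n : ℕ) (B : Mat k) (P : (Mat k)[X]) :
    szegoDual n (P * C B) = C B.conjTranspose * szegoDual n P := by
  ext1 j
  simp only [coeff_szegoDual, coeff_C_mul, coeff_mul_C]
  split_ifs <;> simp [Matrix.conjTranspose_mul]

lemma szegoDual_succ_X_mul (n : ℕ) (P : (Mat k)[X]) :
    szegoDual (n + 1) (X * P) = szegoDual n P := by
  ext1 j
  simp only [coeff_szegoDual]
  split_ifs with h1 h2 h2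
  · rw [show n + 1 - j = (n - j) + 1 by omega, coeff_X_mul]
  · rw [show n + 1 - j = 0 by omega, mul_coeff_zero, coeff_X_zero, zero_mul,
      Matrix.conjTranspose_zero]
  · omega
  · rfl

lemma szegoDual_succ {n : ℕ} {P : (Mat k)[X]} (h : P.natDegree ≤ n) :
    szegoDual (n + 1) P = X * szegoDual n P := by
  ext1 j
  rcases j with _ | j
  · rw [coeff_szegoDual, if_pos (Nat.zero_le _), mul_coeff_zero, coeff_X_zero, zero_mul,
      coeff_eq_zero_of_natDegree_lt (by omega), Matrix.conjTranspose_zero]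
  · simp only [coeff_X_mul, coeff_szegoDual, Nat.add_sub_add_right, Nat.add_le_add_iff_right]

/-- On the circle `1 / z̄ = z`, so the dual is the pointwise adjoint times `z^n`. -/
lemma evalCircle_szegoDual {n : ℕ} {P : (Mat k)[X]} (h : P.natDegree ≤ n) (z : Circle) :
    evalCircle (szegoDual n P) z = (z : ℂ) ^ (n : ℤ) • (evalCircle P z).conjTranspose := by
  rw [evalCircle_eq_sum (natDegree_szegoDual_le n P), evalCircle_eq_sum h,
    ← Finset.sum_range_reflect, Matrix.conjTranspose_sum, Finset.smul_sum]
  refine Finset.sum_congr rfl fun j hj => ?_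
  have hj' : j ≤ n := by rw [Finset.mem_range] at hj; omega
  rw [coeff_szegoDual, if_pos (by omega), Matrix.conjTranspose_smul, smul_smul,
    show n - (n + 1 - 1 - j) = j by omega]
  congr 1
  rw [RCLike.star_def, map_zpow₀, ← Circle.coe_inv_eq_conj, Circle.coe_inv, inv_zpow, ← zpow_neg,
    ← zpow_add₀ (Circle.coe_ne_zero z)]
  congr 1
  omega

/-! ### Orthogonality to monomials -/

variable {μ : MatrixMeasure k}

/-- The function `z ↦ z^n 1`. -/
def mono (k : ℕ) (n : ℤ) (z : Circle) : Mat k := (z : ℂ) ^ n • 1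

@[fun_prop]
lemma continuous_mono (n : ℤ) : Continuous (mono k n) := continuous_zpow_smul n continuous_const

lemma innerR_trig_left {ι : Type*} (s : Finset ι) (e : ι → ℤ) (B : ι → Mat k)
    {F : Circle → Mat k} (hF : Continuous F) :
    innerR μ (fun z => ∑ j ∈ s, (z : ℂ) ^ e j • B j) F =
      ∑ j ∈ s, (B j).conjTranspose * innerR μ (mono k (e j)) F := by
  rw [innerR_sum_left s (fun j => continuous_zpow_smul _ continuous_const) hF]
  refine Finset.sum_congr rfl fun j _ => ?_
  rw [← innerR_mul_left (continuous_mono _) hF]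
  simp only [mono, Matrix.smul_mul, one_mul]

lemma innerR_evalCircle_left {P : (Mat k)[X]} {n : ℕ} (h : P.natDegree ≤ n)
    {F : Circle → Mat k} (hF : Continuous F) :
    innerR μ (evalCircle P) F = ∑ j ∈ Finset.range (n + 1),
      (P.coeff j).conjTranspose * innerR μ (mono k j) F := by
  rw [funext (evalCircle_eq_sum h)]
  exact innerR_trig_left _ _ _ hF

lemma innerR_mono_zpow_smul (m n : ℤ) (F : Circle → Mat k) :
    innerR μ (mono k m) (fun z => (z : ℂ) ^ n • F z) = innerR μ (mono k (m - n)) F := by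
  rw [← neg_neg n, ← innerR_zpow_left, neg_neg]
  congr 1
  ext1 z
  rw [mono, mono, smul_smul, ← zpow_add₀ (Circle.coe_ne_zero z)]
  congr 2; ring

lemma MatrixMeasure.Nontrivial.eq_zero (hμ : μ.Nontrivial) {P : (Mat k)[X]}
    (h : (innerR μ (evalCircle P) (evalCircle P)).trace = 0) : P = 0 := by
  have hP : evalCircle P = fun z : Circle => ∑ l : Fin (P.natDegree + 1),
      (z : ℂ) ^ (l : ℕ) • P.coeff l := by
    ext1 z
    rw [evalCircle_eq_sum le_rfl, Finset.sum_range]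
    simp only [zpow_natCast]
  have := hμ _ (fun l => P.coeff l) (by rw [← hP]; exact h)
  ext1 j
  rw [coeff_zero]
  by_cases hj : j < P.natDegree + 1
  · exact this ⟨j, hj⟩
  · exact coeff_eq_zero_of_natDegree_lt (by omega)

/-- A kernel vector of the Gram matrix, repeated in every column, is a matrix `B` for which `P B`
has norm zero. Nontriviality gives `P B = 0`, and the invertible coefficient of `P` forces `B = 0`.
-/
lemma MatrixMeasure.Nontrivial.posDef (hμ : μ.Nontrivial) {P : (Mat k)[X]} {j : ℕ}
    (hj : IsUnit (P.coeff j)) : (innerR μ (evalCircle P) (evalCircle P)).PosDef := by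
  have hc := continuous_evalCircle P
  rw [← Matrix.isStrictlyPositive_iff_posDef]
  refine IsUnit.isStrictlyPositive ?_ (innerR_self_posSemidef hc).nonneg
  rw [Matrix.isUnit_iff_isUnit_det, isUnit_iff_ne_zero]
  intro hdet
  obtain ⟨x, hx, hG⟩ := Matrix.exists_mulVec_eq_zero_iff.2 hdet
  apply hx
  have hB : innerR μ (evalCircle P) (evalCircle P) *
      (Matrix.of fun i _ => x i : Mat k) = 0 := by
    ext i l
    exact congrFun hG i
  have h0 : P * C (Matrix.of fun i _ => x i) = 0 := by
    apply hμ.eq_zero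
    simp only [funext (evalCircle_mul _ _), evalCircle_C]
    rw [innerR_mul_right (by fun_prop) hc, innerR_mul_left hc hc, mul_assoc, hB, mul_zero,
      Matrix.trace_zero]
  have h1 := congrArg (fun Q => coeff Q j) h0
  simp only [coeff_mul_C, coeff_zero] at h1
  have h2 := hj.mul_right_eq_zero.1 h1
  ext i
  exact congrFun₂ h2 i i

end

section

/-! ### Construction of the orthogonal polynomials by the Szegő recursion -/

/-- `f` and `g` behave like `φ^R_n` and `(φ^L_n)^*`. -/
structure IsSzegoPair (μ : MatrixMeasure k) (n : ℕ) (f g : (Mat k)[X]) : Prop where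
  natDegree_fst : f.natDegree ≤ n
  natDegree_snd : g.natDegree ≤ n
  orth_fst : ∀ j : ℕ, j < n → innerR μ (mono k j) (evalCircle f) = 0
  orth_snd : ∀ j : ℕ, 1 ≤ j → j ≤ n → innerR μ (mono k j) (evalCircle g) = 0
  norm_fst : innerR μ (evalCircle f) (evalCircle f) = 1
  norm_snd : innerR μ (evalCircle g) (evalCircle g) = 1
  isUnit_fst : IsUnit (f.coeff n)
  isUnit_snd : IsUnit (g.coeff 0)

/-- The Verblunsky coefficient of a pair `φ^R_n`, `(φ^L_n)^*`. -/
def verblunsky (μ : MatrixMeasure k) (f g : (Mat k)[X]) : Mat k :=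
  innerR μ (evalCircle (X * f)) (evalCircle g)

/-- One step of the Szegő recursion for `φ^R`. -/
def nextFst (μ : MatrixMeasure k) (f g : (Mat k)[X]) : (Mat k)[X] :=
  (X * f - g * C (verblunsky μ f g).conjTranspose) * C (rhoR (verblunsky μ f g))⁻¹

/-- One step of the Szegő recursion for `(φ^L)^*`. -/
def nextSnd (μ : MatrixMeasure k) (f g : (Mat k)[X]) : (Mat k)[X] :=
  (g - X * f * C (verblunsky μ f g)) * C (rhoL (verblunsky μ f g))⁻¹

variable {μ : MatrixMeasure k}

lemma posDef_inv_mul_cancel {a : Mat k} (h : a.PosDef) : a⁻¹ * a = 1 :=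
  Matrix.nonsing_inv_mul _ ((Matrix.isUnit_iff_isUnit_det a).1 h.isUnit)

lemma posDef_mul_inv_cancel {a : Mat k} (h : a.PosDef) : a * a⁻¹ = 1 :=
  Matrix.mul_nonsing_inv _ ((Matrix.isUnit_iff_isUnit_det a).1 h.isUnit)

lemma natDegree_X_mul_le_succ {P : (Mat k)[X]} {n : ℕ} (h : P.natDegree ≤ n) :
    (X * P).natDegree ≤ n + 1 := by
  have := natDegree_mul_le_of_le (natDegree_X_le (R := Mat k)) h
  omega

lemma innerR_mono_X_mul (j : ℕ) (f : (Mat k)[X]) :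
    innerR μ (mono k (j + 1 : ℕ)) (evalCircle (X * f)) = innerR μ (mono k j) (evalCircle f) := by
  rw [funext (evalCircle_X_mul f), innerR_mono_zpow_smul]
  push_cast
  rw [add_sub_cancel_right]

lemma innerR_X_mul_X_mul (f : (Mat k)[X]) :
    innerR μ (evalCircle (X * f)) (evalCircle (X * f)) =
      innerR μ (evalCircle f) (evalCircle f) := by
  rw [funext (evalCircle_X_mul f), innerR_zpow_zpow]

lemma innerR_evalCircle_mul_C (F : (Mat k)[X]) (P : (Mat k)[X]) (B : Mat k) :
    innerR μ (evalCircle F) (evalCircle (P * C B)) =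
      innerR μ (evalCircle F) (evalCircle P) * B := by
  simp only [funext (evalCircle_mul P _), evalCircle_C]
  exact innerR_mul_right (by fun_prop) (by fun_prop) B

lemma innerR_evalCircle_mul_C_left (F : Circle → Mat k) (hF : Continuous F) (P : (Mat k)[X])
    (B : Mat k) :
    innerR μ (evalCircle (P * C B)) F = B.conjTranspose * innerR μ (evalCircle P) F := by
  simp only [funext (evalCircle_mul P _), evalCircle_C]
  exact innerR_mul_left (by fun_prop) (by fun_prop) B

lemma innerR_sub_mul_C {F : Circle → Mat k} (hF : Continuous F) (P Q : (Mat k)[X]) (B : Mat k) :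
    innerR μ F (evalCircle (P - Q * C B)) =
      innerR μ F (evalCircle P) - innerR μ F (evalCircle Q) * B := by
  simp only [funext (evalCircle_sub P _), funext (evalCircle_mul Q _), evalCircle_C]
  rw [innerR_sub_right (h := fun z => evalCircle Q z * B) hF (by fun_prop) (by fun_prop),
    innerR_mul_right hF (by fun_prop) B]

lemma innerR_sub_mul_C_left {F : Circle → Mat k} (hF : Continuous F) (P Q : (Mat k)[X])
    (B : Mat k) :
    innerR μ (evalCircle (P - Q * C B)) F =
      innerR μ (evalCircle P) F - B.conjTranspose * innerR μ (evalCircle Q) F := by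
  rw [← conjTranspose_innerR, innerR_sub_mul_C hF, Matrix.conjTranspose_sub,
    Matrix.conjTranspose_mul, conjTranspose_innerR, conjTranspose_innerR]

namespace IsSzegoPair

variable {n : ℕ} {f g : (Mat k)[X]}

/-- Only the exponent `0` needs the choice of `α`. That choice makes the difference orthogonal to
`g`, whose other monomials `z, …, z^n` are already handled and whose constant coefficient is
invertible. -/
lemma innerR_mono_fst_step (h : IsSzegoPair μ n f g) (j : ℕ) (hj : j ≤ n) :
    innerR μ (mono k j)
      (evalCircle (X * f - g * C (verblunsky μ f g).conjTranspose)) = 0 := by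
  have hpos : ∀ j : ℕ, j + 1 ≤ n → innerR μ (mono k (j + 1 : ℕ))
      (evalCircle (X * f - g * C (verblunsky μ f g).conjTranspose)) = 0 := by
    intro j hj
    rw [innerR_sub_mul_C (by fun_prop), innerR_mono_X_mul, h.orth_fst j (by omega),
      h.orth_snd _ (by omega) hj, zero_mul, sub_zero]
  rcases j with _ | j
  · have h1 : innerR μ (evalCircle g)
        (evalCircle (X * f - g * C (verblunsky μ f g).conjTranspose)) = 0 := by
      rw [innerR_sub_mul_C (by fun_prop), h.norm_snd, verblunsky, conjTranspose_innerR, one_mul,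
        sub_self]
    rw [innerR_evalCircle_left h.natDegree_snd (by fun_prop), Finset.sum_range_succ',
      Finset.sum_eq_zero, zero_add] at h1
    · have := h.isUnit_snd
      rw [← Matrix.isUnit_conjTranspose] at this
      exact this.mul_right_eq_zero.1 h1
    · intro i hi
      rw [hpos i (by simpa using hi), mul_zero]
  · exact hpos j hj

/-- The mirror argument: only the exponent `n + 1` is new, and it is isolated by pairing with `z f`,
whose top coefficient is invertible. -/
lemma innerR_mono_snd_step (h : IsSzegoPair μ n f g) (j : ℕ) (hj1 : 1 ≤ j) (hj : j ≤ n + 1) :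
    innerR μ (mono k j) (evalCircle (g - X * f * C (verblunsky μ f g))) = 0 := by
  have hpos : ∀ j : ℕ, j + 1 ≤ n → innerR μ (mono k (j + 1 : ℕ))
      (evalCircle (g - X * f * C (verblunsky μ f g))) = 0 := by
    intro j hj
    rw [innerR_sub_mul_C (by fun_prop), innerR_mono_X_mul, h.orth_fst j (by omega),
      h.orth_snd _ (by omega) hj, zero_mul, sub_zero]
  obtain ⟨i, rfl⟩ : ∃ i, j = i + 1 := ⟨j - 1, by omega⟩
  rcases (by omega : i + 1 ≤ n ∨ i = n) with hi | rfl
  · exact hpos i hi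
  · have h1 : innerR μ (evalCircle (X * f))
        (evalCircle (g - X * f * C (verblunsky μ f g))) = 0 := by
      rw [innerR_sub_mul_C (by fun_prop), innerR_X_mul_X_mul, h.norm_fst, verblunsky, one_mul,
        sub_self]
    have hd : (X * f).natDegree ≤ i + 1 :=
      natDegree_X_mul_le_succ h.natDegree_fst
    rw [innerR_evalCircle_left hd (by fun_prop), Finset.sum_range_succ, Finset.sum_eq_zero,
      zero_add, coeff_X_mul] at h1
    · have := h.isUnit_fst
      rw [← Matrix.isUnit_conjTranspose] at this
      exact this.mul_right_eq_zero.1 h1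
    · intro l hl
      rcases l with _ | l
      -- Orthogonality to `1` is not available, but `z f` has no constant term.
      · rw [mul_coeff_zero, coeff_X_zero, zero_mul, Matrix.conjTranspose_zero, zero_mul]
      · rw [hpos l (by simpa using hl), mul_zero]

/-- Pythagoras for `z f = (z f - g α†) + g α†`, where the last summand has Gram matrix `αα†`. -/
lemma norm_fst_step (h : IsSzegoPair μ n f g) :
    innerR μ (evalCircle (X * f - g * C (verblunsky μ f g).conjTranspose))
      (evalCircle (X * f - g * C (verblunsky μ f g).conjTranspose)) =
      1 - verblunsky μ f g * (verblunsky μ f g).conjTranspose := by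
  rw [innerR_sub_mul_C (by fun_prop), innerR_sub_mul_C_left (by fun_prop),
    innerR_sub_mul_C_left (by fun_prop), innerR_X_mul_X_mul, h.norm_fst, h.norm_snd,
    ← conjTranspose_innerR (evalCircle (X * f)) (evalCircle g)]
  change 1 - _ * (verblunsky μ f g).conjTranspose - (verblunsky μ f g - _) * _ = _
  rw [Matrix.conjTranspose_conjTranspose, mul_one, sub_self, zero_mul, sub_zero]

lemma norm_snd_step (h : IsSzegoPair μ n f g) :
    innerR μ (evalCircle (g - X * f * C (verblunsky μ f g)))
      (evalCircle (g - X * f * C (verblunsky μ f g))) =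
      1 - (verblunsky μ f g).conjTranspose * verblunsky μ f g := by
  rw [innerR_sub_mul_C (by fun_prop), innerR_sub_mul_C_left (by fun_prop),
    innerR_sub_mul_C_left (by fun_prop), innerR_X_mul_X_mul, h.norm_fst, h.norm_snd,
    ← conjTranspose_innerR (evalCircle (X * f)) (evalCircle g)]
  change 1 - _ * (verblunsky μ f g) - ((verblunsky μ f g).conjTranspose - _) * _ = _
  rw [mul_one, sub_self, zero_mul, sub_zero]

lemma coeff_fst_step (h : IsSzegoPair μ n f g) (B : Mat k) :
    (X * f - g * C B).coeff (n + 1) = f.coeff n := by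
  rw [coeff_sub, coeff_X_mul, coeff_mul_C, coeff_eq_zero_of_natDegree_lt (p := g)
    (Nat.lt_succ_of_le h.natDegree_snd), zero_mul, sub_zero]

lemma coeff_snd_step (B : Mat k) : (g - X * f * C B).coeff 0 = g.coeff 0 := by
  rw [coeff_sub, coeff_mul_C, mul_coeff_zero, coeff_X_zero, zero_mul, zero_mul, sub_zero]

/-- The two defects are Gram matrices of polynomials that keep the invertible coefficient of `g` at
`0` and of `f` at the top, so nontriviality applies. -/
lemma isContr (h : IsSzegoPair μ n f g) (hμ : μ.Nontrivial) : IsContr (verblunsky μ f g) where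
  left := by
    rw [← h.norm_snd_step]
    exact hμ.posDef (j := 0) (by rw [coeff_snd_step]; exact h.isUnit_snd)
  right := by
    rw [← h.norm_fst_step]
    exact hμ.posDef (j := n + 1) (by rw [h.coeff_fst_step]; exact h.isUnit_fst)

lemma next (h : IsSzegoPair μ n f g) (hμ : μ.Nontrivial) :
    IsSzegoPair μ (n + 1) (nextFst μ f g) (nextSnd μ f g) := by
  have hα := h.isContr hμ
  have hX : (X * f).natDegree ≤ n + 1 :=
    natDegree_X_mul_le_succ h.natDegree_fst
  have hg := h.natDegree_snd
  have hR := hα.rhoR_posDef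
  have hL := hα.rhoL_posDef
  have hC : ∀ (P : (Mat k)[X]) (B : Mat k) (j : ℕ), innerR μ (mono k j) (evalCircle P) = 0 →
      innerR μ (mono k j) (evalCircle (P * C B)) = 0 := by
    intro P B j hj
    simp only [funext (evalCircle_mul P _), evalCircle_C]
    rw [innerR_mul_right (by fun_prop) (by fun_prop), hj, zero_mul]
  have hnorm : ∀ (P : (Mat k)[X]) (r : Mat k), r.PosDef →
      innerR μ (evalCircle P) (evalCircle P) = r * r →
      innerR μ (evalCircle (P * C r⁻¹)) (evalCircle (P * C r⁻¹)) = 1 := by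
    intro P r hr hP
    rw [innerR_evalCircle_mul_C, innerR_evalCircle_mul_C_left _ (by fun_prop), hP,
      hr.inv.isHermitian.eq, ← mul_assoc, posDef_inv_mul_cancel hr, one_mul,
      posDef_mul_inv_cancel hr]
  constructor
  · exact natDegree_mul_C_le _ _ |>.trans ((natDegree_sub_le_of_le hX
      ((natDegree_mul_C_le _ _).trans (hg.trans (Nat.le_succ n)))).trans (max_self _).le)
  · exact natDegree_mul_C_le _ _ |>.trans ((natDegree_sub_le_of_le (hg.trans (Nat.le_succ n))
      ((natDegree_mul_C_le _ _).trans hX)).trans (max_self _).le)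
  · exact fun j hj => hC _ _ _ (h.innerR_mono_fst_step j (by omega))
  · exact fun j h1 hj => hC _ _ _ (h.innerR_mono_snd_step j h1 hj)
  · exact hnorm _ _ hR (by rw [h.norm_fst_step, hα.rhoR_mul_self])
  · exact hnorm _ _ hL (by rw [h.norm_snd_step, hα.rhoL_mul_self])
  · rw [nextFst, coeff_mul_C, h.coeff_fst_step]
    exact h.isUnit_fst.mul hR.inv.isUnit
  · rw [nextSnd, coeff_mul_C, coeff_snd_step]
    exact h.isUnit_snd.mul hL.inv.isUnit

lemma X_mul_fst (h : IsSzegoPair μ n f g) (hμ : μ.Nontrivial) :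
    X * f = nextFst μ f g * C (rhoR (verblunsky μ f g)) +
      g * C (verblunsky μ f g).conjTranspose := by
  rw [nextFst, mul_assoc, ← C_mul, posDef_inv_mul_cancel (h.isContr hμ).rhoR_posDef, C_1, mul_one,
    sub_add_cancel]

lemma snd_eq (h : IsSzegoPair μ n f g) (hμ : μ.Nontrivial) :
    g = nextSnd μ f g * C (rhoL (verblunsky μ f g)) + X * f * C (verblunsky μ f g) := by
  rw [nextSnd, mul_assoc, ← C_mul, posDef_inv_mul_cancel (h.isContr hμ).rhoL_posDef, C_1, mul_one,
    sub_add_cancel]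

lemma zero (μ : MatrixMeasure k) : IsSzegoPair μ 0 1 1 := by
  have h1 : innerR μ (evalCircle 1) (evalCircle 1) = 1 := by
    ext i j
    rw [← μ.normalized i j]
    simp only [innerR, evalCircle_eq_evalHom, map_one, Matrix.conjTranspose_one, one_mul, mul_one,
      Matrix.of_apply]
  constructor <;> first | exact h1 | simp
  intros; omega

end IsSzegoPair

/-- A solution of the Szegő recursion, with `f_n = φ^R_n` and `g_n = (φ^L_n)^*`. -/
structure IsSzegoSeq (μ : MatrixMeasure k) (f g : ℕ → (Mat k)[X]) (α : ℕ → Mat k) : Prop where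
  fst_zero : f 0 = 1
  snd_zero : g 0 = 1
  pair : ∀ n, IsSzegoPair μ n (f n) (g n)
  isContr : ∀ n, IsContr (α n)
  X_mul_fst : ∀ n, X * f n = f (n + 1) * C (rhoR (α n)) + g n * C (α n).conjTranspose
  snd_eq : ∀ n, g n = g (n + 1) * C (rhoL (α n)) + X * f n * C (α n)

lemma exists_isSzegoSeq (hμ : μ.Nontrivial) : ∃ f g α, IsSzegoSeq μ f g α := by
  let s : ℕ → (Mat k)[X] × (Mat k)[X] := fun n =>
    Nat.rec (1, 1) (fun _ p => (nextFst μ p.1 p.2, nextSnd μ p.1 p.2)) n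
  have hs : ∀ n, IsSzegoPair μ n (s n).1 (s n).2 := by
    intro n
    induction n with
    | zero => exact IsSzegoPair.zero μ
    | succ n ih => exact ih.next hμ
  exact ⟨fun n => (s n).1, fun n => (s n).2, fun n => verblunsky μ (s n).1 (s n).2, rfl, rfl, hs,
    fun n => (hs n).isContr hμ, fun n => (hs n).X_mul_fst hμ, fun n => (hs n).snd_eq hμ⟩

/-- A left orthonormal polynomial in terms of its dual, read through the right inner product. -/
lemma conjTranspose_evalCircle_szegoDual {n : ℕ} {P : (Mat k)[X]} (h : P.natDegree ≤ n)
    (z : Circle) :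
    (evalCircle (szegoDual n P) z).conjTranspose = (z : ℂ) ^ (-(n : ℤ)) • evalCircle P z := by
  conv_rhs => rw [← szegoDual_szegoDual h, evalCircle_szegoDual (natDegree_szegoDual_le n P)]
  rw [smul_smul, ← zpow_add₀ (Circle.coe_ne_zero z), neg_add_cancel, zpow_zero, one_smul]

namespace IsSzegoSeq

variable {f g : ℕ → (Mat k)[X]} {α : ℕ → Mat k}

/-- Comparing top coefficients in the recursion gives `κ_{n+1} = κ_n (ρ^R)⁻¹`, so the required ratio
is `(ρ^R)⁻¹ > 0`. -/
lemma isRightOPUC (h : IsSzegoSeq μ f g α) : IsRightOPUC μ f := by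
  have hlt : ∀ n m, n < m → innerR μ (evalCircle (f n)) (evalCircle (f m)) = 0 := by
    intro n m hnm
    rw [innerR_evalCircle_left (h.pair n).natDegree_fst (by fun_prop)]
    refine Finset.sum_eq_zero fun j hj => ?_
    rw [Finset.mem_range] at hj
    rw [(h.pair m).orth_fst j (by omega), mul_zero]
  refine ⟨fun n => (h.pair n).natDegree_fst, fun n m => ?_, by simp [h.fst_zero], fun n => ?_⟩
  · rcases lt_trichotomy n m with hnm | rfl | hnm
    · rw [hlt n m hnm, if_neg hnm.ne]
    · rw [(h.pair n).norm_fst, if_pos rfl]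
    · rw [← conjTranspose_innerR, hlt m n hnm, if_neg hnm.ne', Matrix.conjTranspose_zero]
  · have h1 := congrArg (fun P => coeff P (n + 1)) (h.X_mul_fst n)
    simp only [coeff_X_mul, coeff_add, coeff_mul_C] at h1
    rw [coeff_eq_zero_of_natDegree_lt (p := g n)
      (Nat.lt_succ_of_le (h.pair n).natDegree_snd), zero_mul, add_zero] at h1
    have hR := (h.isContr n).rhoR_posDef
    have h2 : (f (n + 1)).coeff (n + 1) = (f n).coeff n * (rhoR (α n))⁻¹ := by
      rw [h1, mul_assoc, posDef_mul_inv_cancel hR, mul_one]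
    rw [h2, ← mul_assoc, Matrix.nonsing_inv_mul _
      ((Matrix.isUnit_iff_isUnit_det _).1 (h.pair n).isUnit_fst), one_mul]
    exact hR.inv

/-- The adjoint of `φ^L_n` is `z^{-n} g_n`, and its leading coefficient is the adjoint of the
constant coefficient of `g_n`. -/
lemma isLeftOPUC (h : IsSzegoSeq μ f g α) : IsLeftOPUC μ fun n => szegoDual n (g n) := by
  have hlt : ∀ n m : ℕ, n < m → innerR μ (fun z => (z : ℂ) ^ (-(n : ℤ)) • evalCircle (g n) z)
      (fun z => (z : ℂ) ^ (-(m : ℤ)) • evalCircle (g m) z) = 0 := by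
    intro n m hnm
    rw [innerR_zpow_left]
    simp only [smul_smul, ← zpow_add₀ (Circle.coe_ne_zero _)]
    rw [innerR_evalCircle_left (h.pair n).natDegree_snd (by fun_prop)]
    refine Finset.sum_eq_zero fun j hj => ?_
    rw [Finset.mem_range] at hj
    rw [innerR_mono_zpow_smul]
    -- For `0 ≤ j ≤ n < m` the exponent `j + m - n` lies between `1` and `m`, exactly where `g_m` is
    -- orthogonal.
    have : (j : ℤ) - (- -(n : ℤ) + -(m : ℤ)) = ((j + (m - n) : ℕ) : ℤ) := by omega
    rw [this, (h.pair m).orth_snd _ (by omega) (by omega), mul_zero]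
  have hc : ∀ n, (szegoDual n (g n)).coeff n = ((g n).coeff 0).conjTranspose := fun n => by
    rw [coeff_szegoDual, if_pos le_rfl, Nat.sub_self]
  refine ⟨fun n => natDegree_szegoDual_le _ _, fun n m => ?_, ?_, fun n => ?_⟩
  · rw [innerL_eq_innerR]
    simp only [conjTranspose_evalCircle_szegoDual (h.pair _).natDegree_snd]
    rcases lt_trichotomy n m with hnm | rfl | hnm
    · rw [← conjTranspose_innerR, hlt n m hnm, if_neg hnm.ne, Matrix.conjTranspose_zero]
    · rw [innerR_zpow_zpow, (h.pair n).norm_snd, if_pos rfl]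
    · rw [hlt m n hnm, if_neg hnm.ne']
  · rw [hc, h.snd_zero, coeff_one_zero, Matrix.conjTranspose_one]
  · simp only [hc]
    have h1 := congrArg (fun P => coeff P 0) (h.snd_eq n)
    simp only [coeff_add, mul_coeff_zero, coeff_X_zero, coeff_C_zero, zero_mul, add_zero] at h1
    have hL := (h.isContr n).rhoL_posDef
    have h2 : (g (n + 1)).coeff 0 = (g n).coeff 0 * (rhoL (α n))⁻¹ := by
      rw [h1, mul_assoc, posDef_mul_inv_cancel hL, mul_one]
    rw [h2, Matrix.conjTranspose_mul, mul_assoc, Matrix.mul_nonsing_inv _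
      ((Matrix.isUnit_iff_isUnit_det _).1 ((Matrix.isUnit_conjTranspose _).2
        (h.pair n).isUnit_snd)), mul_one, hL.inv.isHermitian.eq]
    exact hL.inv

/-- Two relations are the recursion itself. The other two are its duals at index `n + 1`, where the
dual of `g_n` is `z φ^L_n` and the dual of `z f_n` is `(φ^R_n)^*`. -/
lemma isVerblunsky (h : IsSzegoSeq μ f g α) :
    IsVerblunsky (fun n => szegoDual n (g n)) f α := by
  have hg := fun n => (h.pair n).natDegree_snd
  refine ⟨fun n => (h.isContr n).norm_lt_one, fun n => ?_, fun n => ?_, fun n => ?_, fun n => ?_⟩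
  · rw [← szegoDual_succ (hg n)]
    conv_lhs => rw [h.snd_eq n]
    rw [szegoDual_add, szegoDual_mul_C, szegoDual_mul_C, szegoDual_succ_X_mul,
      (h.isContr n).rhoL_posDef.isHermitian.eq]
  · rw [szegoDual_szegoDual (hg n)]
    exact h.X_mul_fst n
  · rw [szegoDual_szegoDual (hg n), szegoDual_szegoDual (hg (n + 1))]
    exact h.snd_eq n
  · rw [← szegoDual_succ_X_mul, h.X_mul_fst n, szegoDual_add, szegoDual_mul_C, szegoDual_mul_C,
      (h.isContr n).rhoR_posDef.isHermitian.eq, szegoDual_succ (hg n),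
      Matrix.conjTranspose_conjTranspose]

/-- The inverse of the Szegő recursion. -/
lemma snd_succ_eq (h : IsSzegoSeq μ f g α) (n : ℕ) :
    g (n + 1) = g n * C (rhoL (α n)) - f (n + 1) * C (α n) := by
  have hα := h.isContr n
  -- After substituting for `z f_n`, the relation `ρ^R α = α ρ^L` brings `ρ^L` to the right. Since
  -- `1 - α†α` is the square of `ρ^L`, one invertible factor `ρ^L` then cancels.
  have h1 : g n = g (n + 1) * C (rhoL (α n)) + (f (n + 1) * C (α n)) * C (rhoL (α n)) +
      g n * C ((α n).conjTranspose * α n) := by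
    conv_lhs => rw [h.snd_eq n, h.X_mul_fst n]
    rw [add_mul, mul_assoc (f (n + 1)), mul_assoc (g n), ← C_mul, ← C_mul, hα.rhoR_mul,
      mul_assoc (f (n + 1)), ← C_mul, add_assoc]
  have h2 : g n * C (rhoL (α n)) * C (rhoL (α n)) =
      (g (n + 1) + f (n + 1) * C (α n)) * C (rhoL (α n)) := by
    rw [mul_assoc, ← C_mul, hα.rhoL_mul_self, C_sub, C_1, mul_sub, mul_one, add_mul,
      sub_eq_iff_eq_add]
    exact h1
  have hu : IsUnit (C (rhoL (α n))) := hα.rhoL_posDef.isUnit.map C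
  rw [hu.mul_right_cancel h2, add_sub_cancel_right]

end IsSzegoSeq

end

section

/-! ### Uniqueness of normalized orthonormal sequences -/

/-- The function `∑_{j < n} z^{e_j} B_j`. -/
def trig (e : ℕ → ℤ) (n : ℕ) (B : ℕ → Mat k) (z : Circle) : Mat k :=
  ∑ j ∈ Finset.range n, (z : ℂ) ^ e j • B j

@[fun_prop]
lemma continuous_trig (e : ℕ → ℤ) (n : ℕ) (B : ℕ → Mat k) : Continuous (trig e n B) :=
  continuous_finsetSum _ fun _ _ => continuous_zpow_smul _ continuous_const

/-- The functions `∑_{j ≤ n} z^{e_j} a_{nj}` are orthonormal for `⟨⟨·, ·⟩⟩_R`, with normalized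
leading coefficients. -/
structure IsOrthonormalTrig (μ : MatrixMeasure k) (e : ℕ → ℤ) (a : ℕ → ℕ → Mat k) : Prop where
  orthonormal : ∀ n m,
    innerR μ (trig e (n + 1) (a n)) (trig e (m + 1) (a m)) = if n = m then 1 else 0
  leading_zero : a 0 0 = 1
  leading_succ : ∀ n, ((a n n)⁻¹ * a (n + 1) (n + 1)).PosDef

namespace IsOrthonormalTrig

variable {μ : MatrixMeasure k} {e : ℕ → ℤ} {a b : ℕ → ℕ → Mat k}

lemma isUnit_leading (h : IsOrthonormalTrig μ e a) (n : ℕ) : IsUnit (a n n) := by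
  induction n with
  | zero => rw [h.leading_zero]; exact isUnit_one
  | succ n ih =>
    have h1 := ih.mul (h.leading_succ n).isUnit
    rwa [← mul_assoc, Matrix.mul_nonsing_inv _ ((Matrix.isUnit_iff_isUnit_det _).1 ih),
      one_mul] at h1

/-- The leading coefficients are invertible, so orthogonality to the earlier functions passes to the
earlier monomials by triangularity. -/
lemma innerR_mono (h : IsOrthonormalTrig μ e a) {n : ℕ} (j : ℕ) (hj : j < n) :
    innerR μ (mono k (e j)) (trig e (n + 1) (a n)) = 0 := by
  induction j using Nat.strong_induction_on with
  | _ j ih =>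
    have h1 : innerR μ (trig e (j + 1) (a j)) (trig e (n + 1) (a n)) = 0 := by
      rw [h.orthonormal, if_neg hj.ne]
    have h2 : innerR μ (trig e (j + 1) (a j)) (trig e (n + 1) (a n)) = _ :=
      innerR_trig_left _ _ _ (by fun_prop)
    rw [h1, Finset.sum_range_succ, Finset.sum_eq_zero, zero_add] at h2
    · exact ((Matrix.isUnit_conjTranspose _).2 (h.isUnit_leading j)).mul_right_eq_zero.1 h2.symm
    · intro i hi
      rw [Finset.mem_range] at hi
      rw [ih i hi (hi.trans hj), mul_zero]

/-- Choose `c` to match the leading coefficients. Then `b_n - a_n c` lies in the span of the first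
`n` monomials and is orthogonal to them, so it vanishes by `he`. Comparing norms gives `c†c = 1`. -/
lemma exists_unitary (he : ∀ n (d : ℕ → Mat k),
      (innerR μ (trig e n d) (trig e n d)).trace = 0 → ∀ j < n, d j = 0)
    (ha : IsOrthonormalTrig μ e a) (hb : IsOrthonormalTrig μ e b) (n : ℕ) :
    ∃ c : Mat k, c.conjTranspose * c = 1 ∧ ∀ j ≤ n, b n j = a n j * c := by
  set c := (a n n)⁻¹ * b n n with hc
  have hlead : b n n = a n n * c := by
    rw [hc, ← mul_assoc, Matrix.mul_nonsing_inv _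
      ((Matrix.isUnit_iff_isUnit_det _).1 (ha.isUnit_leading n)), one_mul]
  have hd : trig e n (fun j => b n j - a n j * c) =
      fun z => trig e (n + 1) (b n) z - trig e (n + 1) (a n) z * c := by
    ext1 z
    simp only [trig, Finset.sum_range_succ, hlead, add_mul, Finset.sum_mul, Matrix.smul_mul,
      smul_sub, Finset.sum_sub_distrib]
    abel
  have hzero : ∀ j < n, b n j - a n j * c = 0 := by
    apply he
    have h1 : innerR μ (trig e n fun j => b n j - a n j * c)
        (trig e n fun j => b n j - a n j * c) = _ :=
      innerR_trig_left _ _ _ (by fun_prop)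
    rw [h1, Finset.sum_eq_zero, Matrix.trace_zero]
    intro j hj
    rw [Finset.mem_range] at hj
    rw [hd, innerR_sub_right (h := fun z => trig e (n + 1) (a n) z * c) (by fun_prop)
      (by fun_prop) (by fun_prop), innerR_mul_right (by fun_prop) (by fun_prop),
      hb.innerR_mono j hj, ha.innerR_mono j hj, zero_mul, sub_zero, mul_zero]
  have hall : ∀ j ≤ n, b n j = a n j * c := fun j hj => by
    rcases hj.lt_or_eq with hj | rfl
    · exact sub_eq_zero.1 (hzero j hj)
    · exact hlead
  refine ⟨c, ?_, hall⟩
  have h2 : trig e (n + 1) (b n) = fun z => trig e (n + 1) (a n) z * c := by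
    ext1 z
    rw [trig, trig, Finset.sum_mul]
    refine Finset.sum_congr rfl fun j hj => ?_
    rw [Finset.mem_range] at hj
    rw [hall j (by omega), Matrix.smul_mul]
  have h3 := hb.orthonormal n n
  rw [h2, innerR_mul_right (by fun_prop) (by fun_prop), innerR_mul_left (by fun_prop)
    (by fun_prop), ha.orthonormal, if_pos rfl, mul_one] at h3
  exact h3

/-- General exponents serve both cases: `e_j = j` for the right polynomials and `e_j = -j` for the
adjoints of the left ones. -/
lemma unique (he : ∀ n (d : ℕ → Mat k),
      (innerR μ (trig e n d) (trig e n d)).trace = 0 → ∀ j < n, d j = 0)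
    (ha : IsOrthonormalTrig μ e a) (hb : IsOrthonormalTrig μ e b) (n : ℕ) :
    ∀ j ≤ n, b n j = a n j := by
  induction n with
  | zero =>
    intro j hj
    rw [Nat.le_zero.1 hj, ha.leading_zero, hb.leading_zero]
  | succ n ih =>
    obtain ⟨c, hc, hj⟩ := ha.exists_unitary he hb (n + 1)
    have hc1 : c = 1 := by
      refine eq_one_of_posDef_mul (ha.leading_succ n) (hb.leading_succ n) ?_ hc
      rw [ih n le_rfl, hj _ le_rfl, mul_assoc]
    intro j h
    rw [hj j h, hc1, mul_one]

end IsOrthonormalTrig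

variable {μ : MatrixMeasure k}

lemma MatrixMeasure.Nontrivial.trig_eq_zero (hμ : μ.Nontrivial) (n : ℕ) (d : ℕ → Mat k)
    (h : (innerR μ (trig (fun j => (j : ℤ)) n d) (trig (fun j => (j : ℤ)) n d)).trace = 0) :
    ∀ j < n, d j = 0 := by
  have h1 : trig (fun j => (j : ℤ)) n d = fun z : Circle => ∑ l : Fin n, (z : ℂ) ^ (l : ℕ) • d l := by
    ext1 z
    rw [trig, Finset.sum_range]
    simp only [zpow_natCast]
  rw [h1] at h
  exact fun j hj => hμ n (fun l => d l) h ⟨j, hj⟩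

/-- Multiplication by `z^{n-1}` preserves the inner product and turns the sum into a polynomial with
reversed coefficients. -/
lemma MatrixMeasure.Nontrivial.trig_neg_eq_zero (hμ : μ.Nontrivial) (n : ℕ) (d : ℕ → Mat k)
    (h : (innerR μ (trig (fun j => -(j : ℤ)) n d) (trig (fun j => -(j : ℤ)) n d)).trace = 0) :
    ∀ j < n, d j = 0 := by
  have h1 : trig (fun j => -(j : ℤ)) n d = fun z : Circle =>
      (z : ℂ) ^ (1 - (n : ℤ)) • trig (fun j => (j : ℤ)) n (fun j => d (n - 1 - j)) z := by
    ext1 z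
    rw [trig, trig, Finset.smul_sum, ← Finset.sum_range_reflect]
    refine Finset.sum_congr rfl fun j hj => ?_
    rw [Finset.mem_range] at hj
    rw [smul_smul, ← zpow_add₀ (Circle.coe_ne_zero z)]
    congr 2
    omega
  rw [h1, innerR_zpow_zpow] at h
  intro j hj
  have := hμ.trig_eq_zero n _ h (n - 1 - j) (by omega)
  rwa [show n - 1 - (n - 1 - j) = j by omega] at this

lemma IsRightOPUC.isOrthonormalTrig {φ : ℕ → (Mat k)[X]} (h : IsRightOPUC μ φ) :
    IsOrthonormalTrig μ (fun j => (j : ℤ)) fun n j => (φ n).coeff j := by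
  refine ⟨fun n m => ?_, h.leading_zero, h.leading_succ⟩
  rw [← h.orthonormal, funext (evalCircle_eq_sum (h.natDegree_le n)),
    funext (evalCircle_eq_sum (h.natDegree_le m))]
  rfl

lemma IsLeftOPUC.isOrthonormalTrig {φ : ℕ → (Mat k)[X]} (h : IsLeftOPUC μ φ) :
    IsOrthonormalTrig μ (fun j => -(j : ℤ)) fun n j => ((φ n).coeff j).conjTranspose := by
  have h1 : ∀ n, trig (fun j => -(j : ℤ)) (n + 1) (fun j => ((φ n).coeff j).conjTranspose) =
      fun z => (evalCircle (φ n) z).conjTranspose := by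
    intro n
    ext1 z
    rw [trig, evalCircle_eq_sum (h.natDegree_le n), Matrix.conjTranspose_sum]
    refine Finset.sum_congr rfl fun j _ => ?_
    rw [Matrix.conjTranspose_smul, RCLike.star_def, map_zpow₀, ← Circle.coe_inv_eq_conj,
      Circle.coe_inv, inv_zpow, zpow_neg]
  refine ⟨fun n m => ?_, ?_, fun n => ?_⟩
  · rw [h1, h1, ← innerL_eq_innerR, h.orthonormal]
    simp only [eq_comm]
  · rw [h.leading_zero, Matrix.conjTranspose_one]
  · rw [← Matrix.conjTranspose_nonsing_inv, ← Matrix.conjTranspose_mul,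
      (h.leading_succ n).isHermitian.eq]
    exact h.leading_succ n

lemma IsRightOPUC.unique (hμ : μ.Nontrivial) {φ ψ : ℕ → (Mat k)[X]} (h : IsRightOPUC μ φ)
    (h' : IsRightOPUC μ ψ) : ψ = φ := by
  ext1 n
  ext1 j
  by_cases hj : j ≤ n
  · exact h.isOrthonormalTrig.unique hμ.trig_eq_zero h'.isOrthonormalTrig n j hj
  · rw [coeff_eq_zero_of_natDegree_lt ((h.natDegree_le n).trans_lt (not_le.1 hj)),
      coeff_eq_zero_of_natDegree_lt ((h'.natDegree_le n).trans_lt (not_le.1 hj))]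

lemma IsLeftOPUC.unique (hμ : μ.Nontrivial) {φ ψ : ℕ → (Mat k)[X]} (h : IsLeftOPUC μ φ)
    (h' : IsLeftOPUC μ ψ) : ψ = φ := by
  ext1 n
  ext1 j
  by_cases hj : j ≤ n
  · exact Matrix.conjTranspose_injective
      (h.isOrthonormalTrig.unique hμ.trig_neg_eq_zero h'.isOrthonormalTrig n j hj)
  · rw [coeff_eq_zero_of_natDegree_lt ((h.natDegree_le n).trans_lt (not_le.1 hj)),
      coeff_eq_zero_of_natDegree_lt ((h'.natDegree_le n).trans_lt (not_le.1 hj))]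

/-- Since `f_{n+1}` is orthogonal to `g_n`, pairing the recursion for `z f_n` with `g_n` isolates
`α_n†`. The factor `r` in `key` is arbitrary, so the unknown `ρ` of the competitor plays no role. -/
lemma IsSzegoSeq.verblunsky_unique {f g : ℕ → (Mat k)[X]} {α β : ℕ → Mat k}
    (h : IsSzegoSeq μ f g α) (hβ : IsVerblunsky (fun n => szegoDual n (g n)) f β) : β = α := by
  have key : ∀ n (B r : Mat k), X * f n = f (n + 1) * C r + g n * C B →
      B = innerR μ (evalCircle (g n)) (evalCircle (X * f n)) := by
    intro n B r hB
    have h0 : innerR μ (evalCircle (g n)) (evalCircle (f (n + 1))) = 0 := by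
      rw [innerR_evalCircle_left (h.pair n).natDegree_snd (by fun_prop)]
      refine Finset.sum_eq_zero fun j hj => ?_
      rw [(h.pair (n + 1)).orth_fst j (by simpa using hj), mul_zero]
    have h1 : f (n + 1) * C r = X * f n - g n * C B := by rw [hB, add_sub_cancel_right]
    have h2 := innerR_evalCircle_mul_C (μ := μ) (g n) (f (n + 1)) r
    rw [h0, zero_mul, h1, innerR_sub_mul_C (by fun_prop), (h.pair n).norm_snd, one_mul] at h2
    exact (sub_eq_zero.1 h2).symm
  ext1 n
  have h1 := hβ.right n
  rw [szegoDual_szegoDual (h.pair n).natDegree_snd] at h1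
  exact Matrix.conjTranspose_injective ((key n _ _ h1).trans (key n _ _ (h.X_mul_fst n)).symm)

end

section

/-! ### Module spans -/

/-- The map `i` inverts the enumeration `e`, and the first `l + 1` exponents fill the window from
`-c` to `l - c`. -/
lemma inModuleSpan_of_reindex {e : ℕ → ℤ} {l : ℕ} {c : ℤ} (i : ℤ → ℕ)
    (h1 : ∀ j ≤ l, 0 ≤ e j + c ∧ e j + c ≤ l) (h2 : ∀ m : ℤ, 0 ≤ m → m ≤ l → i (m - c) ≤ l)
    (h3 : ∀ j, i (e j) = j) (h4 : ∀ m, e (i m) = m) {P : (Mat k)[X]} (hP : P.natDegree ≤ l) :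
    InModuleSpan e (l + 1) fun z : Circle => (z : ℂ) ^ (-c) • evalCircle P z := by
  refine ⟨fun j => P.coeff (e j + c).toNat, fun z => ?_⟩
  beta_reduce
  rw [Fin.sum_univ_eq_sum_range (fun j => (z : ℂ) ^ e j • P.coeff (e j + c).toNat),
    evalCircle_eq_sum hP, Finset.smul_sum]
  refine Finset.sum_nbij' (fun m => i ((m : ℤ) - c)) (fun j => (e j + c).toNat) ?_ ?_ ?_ ?_ ?_
  · intro m hm
    rw [Finset.mem_range] at hm ⊢
    exact Nat.lt_succ_of_le (h2 m (by omega) (by omega))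
  · intro j hj
    rw [Finset.mem_range] at hj ⊢
    have := h1 j (by omega)
    omega
  · intro m hm
    simp only [h4]
    omega
  · intro j hj
    rw [Finset.mem_range] at hj
    have := h1 j (by omega)
    simp only [Int.toNat_of_nonneg this.1, add_sub_cancel_right, h3]
  · intro m hm
    rw [smul_smul, ← zpow_add₀ (Circle.coe_ne_zero z), h4, sub_add_cancel, Int.toNat_natCast,
      neg_add_eq_sub]

lemma cmvExponent_eq (j : ℕ) :
    cmvExponent j = if j % 2 = 0 then -((j / 2 : ℕ) : ℤ) else ((j + 1) / 2 : ℕ) := by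
  simp only [cmvExponent, Nat.even_iff]

lemma inModuleSpan_cmvExponent {l : ℕ} {P : (Mat k)[X]} (hP : P.natDegree ≤ l) :
    InModuleSpan cmvExponent (l + 1) fun z : Circle =>
      (z : ℂ) ^ (-((l / 2 : ℕ) : ℤ)) • evalCircle P z := by
  refine inModuleSpan_of_reindex
    -- In `0, 1, -1, 2, -2, …` a positive `m` sits at position `2m - 1` and a nonpositive one at
    -- `-2m`.
    (fun m => if 0 < m then (2 * m - 1).toNat else (-2 * m).toNat) ?_ ?_ ?_ ?_ hP
  all_goals
    intros
    try simp only [cmvExponent_eq]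
    split_ifs <;> omega

lemma inModuleSpan_neg_cmvExponent {l : ℕ} {P : (Mat k)[X]} (hP : P.natDegree ≤ l) :
    InModuleSpan (fun j => -cmvExponent j) (l + 1) fun z : Circle =>
      (z : ℂ) ^ (-(((l + 1) / 2 : ℕ) : ℤ)) • evalCircle P z := by
  refine inModuleSpan_of_reindex
    (fun m => if m < 0 then (-2 * m - 1).toNat else (2 * m).toNat) ?_ ?_ ?_ ?_ hP
  all_goals
    intros
    try simp only [cmvExponent_eq]
    split_ifs <;> omega

lemma cmvChi_eq (φ ψ : ℕ → (Mat k)[X]) (l : ℕ) : cmvChi φ ψ l = fun z : Circle =>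
    (z : ℂ) ^ (-((l / 2 : ℕ) : ℤ)) •
      evalCircle (if Even l then szegoDual l (ψ l) else φ l) z := by
  ext1 z
  rw [cmvChi]
  split_ifs <;> rfl

lemma cmvX_eq (φ ψ : ℕ → (Mat k)[X]) (l : ℕ) : cmvX φ ψ l = fun z : Circle =>
    (z : ℂ) ^ (-(((l + 1) / 2 : ℕ) : ℤ)) •
      evalCircle (if Even l then φ l else szegoDual l (ψ l)) z := by
  ext1 z
  rw [cmvX]
  split_ifs <;> rfl

lemma inModuleSpan_cmvChi {φ : ℕ → (Mat k)[X]} (hφ : ∀ n, (φ n).natDegree ≤ n)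
    (ψ : ℕ → (Mat k)[X]) (l : ℕ) : InModuleSpan cmvExponent (l + 1) (cmvChi φ ψ l) := by
  rw [cmvChi_eq]
  refine inModuleSpan_cmvExponent ?_
  split_ifs
  · exact natDegree_szegoDual_le _ _
  · exact hφ l

lemma inModuleSpan_cmvX {φ : ℕ → (Mat k)[X]} (hφ : ∀ n, (φ n).natDegree ≤ n)
    (ψ : ℕ → (Mat k)[X]) (l : ℕ) :
    InModuleSpan (fun j => -cmvExponent j) (l + 1) (cmvX φ ψ l) := by
  rw [cmvX_eq]
  refine inModuleSpan_neg_cmvExponent ?_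
  split_ifs
  · exact hφ l
  · exact natDegree_szegoDual_le _ _

/-! ### Expansions and block matrices -/

/-- `y_l = ∑_m u_m T_{ml}`, a finite sum for every `l`. -/
def IsExpansion (u y : ℕ → Circle → Mat k) (T : Matrix ℕ ℕ (Mat k)) : Prop :=
  ∀ l, ∃ s : Finset ℕ, (∀ m ∉ s, T m l = 0) ∧ ∀ z, y l z = ∑ m ∈ s, u m z * T m l

variable {μ : MatrixMeasure k} {u v y : ℕ → Circle → Mat k} {T : Matrix ℕ ℕ (Mat k)}

lemma IsExpansion.mulZ (h : IsExpansion u y T) :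
    IsExpansion (fun l => mulZ (u l)) (fun l => mulZ (y l)) T := by
  intro l
  obtain ⟨s, hs, hy⟩ := h l
  refine ⟨s, hs, fun z => ?_⟩
  simp only [MatrixCMV.mulZ, hy, Finset.smul_sum, Matrix.smul_mul]

lemma IsExpansion.innerR_eq (h : IsExpansion u y T) (hu : ∀ m, Continuous (u m))
    {F : Circle → Mat k} (hF : Continuous F) (l : ℕ) :
    ∃ s : Finset ℕ, (∀ m ∉ s, T m l = 0) ∧
      innerR μ F (y l) = ∑ m ∈ s, innerR μ F (u m) * T m l := by
  obtain ⟨s, hs, hy⟩ := h l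
  refine ⟨s, hs, ?_⟩
  rw [funext hy, innerR_sum_right s (g := fun m z => u m z * T m l) hF
    fun m => (hu m).mul continuous_const]
  exact Finset.sum_congr rfl fun m _ => innerR_mul_right hF (hu m) _

lemma IsExpansion.gramR_eq (h : IsExpansion u y T) (hu : ∀ m, Continuous (u m))
    (ho : ∀ l m, innerR μ (u l) (u m) = if l = m then 1 else 0) : gramR μ u y = T := by
  ext j l : 1
  obtain ⟨s, hs, hy⟩ := h.innerR_eq (μ := μ) hu (hu j) l
  rw [gramR, Matrix.of_apply, hy]
  simp only [ho, ite_mul, one_mul, zero_mul, Finset.sum_ite_eq]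
  split_ifs with hj
  · rfl
  · exact (hs j hj).symm

/-- The expansion of `y_l` is an exact finite sum, so it can be paired termwise with any continuous
`v_j`. Neither `u` nor `v` need be orthonormal. -/
lemma IsExpansion.isBlockProduct (h : IsExpansion u y T) (hu : ∀ m, Continuous (u m))
    (hv : ∀ m, Continuous (v m)) : IsBlockProduct (gramR μ v y) (gramR μ v u) T := by
  intro j l
  obtain ⟨s, hs, hy⟩ := h.innerR_eq (μ := μ) hu (hv j) l
  have hsupp : (Function.support fun m => gramR μ v u j m * T m l) ⊆ s := by
    intro m hm
    by_contra hms
    exact hm (by simp only [hs m hms, mul_zero])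
  refine ⟨s.finite_toSet.subset hsupp, ?_⟩
  rw [finsum_eq_sum_of_support_subset _ hsupp]
  exact hy

lemma directSum_apply (T : ℕ → Matrix (Fin 2) (Fin 2) (Mat k)) (p q : ℕ) (a b : Fin 2) :
    directSum T (2 * p + a) (2 * q + b) = if p = q then T p a b else 0 := by
  have h : ∀ (p : ℕ) (a : Fin 2), (2 * p + a) / 2 = p ∧ Fin.ofNat 2 (2 * p + a) = a := by
    intro p a
    refine ⟨by omega, Fin.ext ?_⟩
    simp only [Fin.ofNat]
    omega
  rw [directSum, Matrix.of_apply, (h p a).1, (h q b).1, (h p a).2, (h q b).2]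

lemma isExpansion_directSum {T : ℕ → Matrix (Fin 2) (Fin 2) (Mat k)}
    (h : ∀ i (b : Fin 2) z, y (2 * i + b) z =
      u (2 * i) z * T i 0 b + u (2 * i + 1) z * T i 1 b) : IsExpansion u y (directSum T) := by
  intro l
  obtain ⟨i, b, rfl⟩ : ∃ (i : ℕ) (b : Fin 2), l = 2 * i + b :=
    ⟨l / 2, ⟨l % 2, Nat.mod_lt _ two_pos⟩, (Nat.div_add_mod l 2).symm⟩
  refine ⟨{2 * i, 2 * i + 1}, fun m hm => ?_, fun z => ?_⟩
  · obtain ⟨p, a, rfl⟩ : ∃ (p : ℕ) (a : Fin 2), m = 2 * p + a :=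
      ⟨m / 2, ⟨m % 2, Nat.mod_lt _ two_pos⟩, (Nat.div_add_mod m 2).symm⟩
    rw [directSum_apply, if_neg]
    rintro rfl
    simp only [Finset.mem_insert, Finset.mem_singleton] at hm
    omega
  · have h0 := directSum_apply T i i 0 b
    have h1 := directSum_apply T i i 1 b
    rw [if_pos rfl] at h0 h1
    rw [Finset.sum_pair (by omega), h]
    exact congrArg₂ _ (congrArg _ h0.symm) (congrArg _ h1.symm)

lemma IsExpansion.oneDirectSum (h0 : ∀ z, y 0 z = u 0 z)
    (h : IsExpansion (fun l => u (l + 1)) (fun l => y (l + 1)) T) :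
    IsExpansion u y (oneDirectSum T) := by
  intro l
  rcases l with _ | l
  · refine ⟨{0}, fun m hm => ?_, fun z => ?_⟩
    · rcases m with _ | m
      · simp at hm
      · rfl
    · rw [Finset.sum_singleton, h0]
      exact (mul_one _).symm
  · obtain ⟨s, hs, hy⟩ := h l
    refine ⟨s.map ⟨Nat.succ, Nat.succ_injective⟩, fun m hm => ?_, fun z => ?_⟩
    · rcases m with _ | m
      · rfl
      · exact hs m fun hms => hm (Finset.mem_map_of_mem _ hms)
    · rw [Finset.sum_map]
      exact hy z

/-! ### The CMV functions of a Szegő sequence -/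

lemma innerR_conjTranspose_mulZ (f g : Circle → Mat k) :
    innerR μ (fun z => (mulZ f z).conjTranspose) g =
      innerR μ (fun z => (f z).conjTranspose) (mulZ g) := by
  have h := innerR_zpow_left (μ := μ) (-1) (fun z => (f z).conjTranspose) g
  rw [neg_neg] at h
  simp only [zpow_one] at h
  refine Eq.trans ?_ h
  congr 1
  ext1 z
  rw [mulZ, Matrix.conjTranspose_smul, RCLike.star_def, ← Circle.coe_inv_eq_conj, Circle.coe_inv,
    zpow_neg_one]

/-- The index exchange built into `gramL` cancels the reversal of arguments caused by taking
adjoints. -/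
lemma gramL_eq_gramR {u' y' : ℕ → Circle → Mat k} (hu : ∀ l z, (u l z).conjTranspose = u' l z)
    (hy : ∀ l z, (y l z).conjTranspose = y' l z) : gramL μ u y = gramR μ y' u' := by
  ext j l : 1
  simp only [gramL, gramR, Matrix.of_apply, innerL_eq_innerR, hu, hy]

lemma gramL_mulZ_eq_gramR {u' y' : ℕ → Circle → Mat k}
    (hu : ∀ l z, (u l z).conjTranspose = u' l z) (hy : ∀ l z, (y l z).conjTranspose = y' l z) :
    gramL μ u (fun l => mulZ (y l)) = gramR μ y' fun l => mulZ (u' l) := by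
  ext j l : 1
  simp only [gramL, gramR, Matrix.of_apply, innerL_eq_innerR]
  rw [innerR_conjTranspose_mulZ]
  simp only [hy, hu]

/-- Moving the powers of `z` across turns the pairing into that of `z^{j - c_l + c_m}` with `P_m`.
Only `l < m` has to be checked, the rest following by adjoints. -/
lemma innerR_eq_ite_of_orthogonal {P : ℕ → (Mat k)[X]} (c : ℕ → ℤ)
    (hP : ∀ n, (P n).natDegree ≤ n) (h1 : ∀ n, innerR μ (evalCircle (P n)) (evalCircle (P n)) = 1)
    (h0 : ∀ l m, l < m → ∀ j : ℕ, j ≤ l →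
      innerR μ (mono k (j - c l + c m)) (evalCircle (P m)) = 0) (l m : ℕ) :
    innerR μ (fun z : Circle => (z : ℂ) ^ (-c l) • evalCircle (P l) z)
      (fun z : Circle => (z : ℂ) ^ (-c m) • evalCircle (P m) z) = if l = m then 1 else 0 := by
  have hlt : ∀ l m, l < m → innerR μ (fun z : Circle => (z : ℂ) ^ (-c l) • evalCircle (P l) z)
      (fun z : Circle => (z : ℂ) ^ (-c m) • evalCircle (P m) z) = 0 := by
    intro l m hlm
    rw [innerR_zpow_left]
    simp only [smul_smul, ← zpow_add₀ (Circle.coe_ne_zero _)]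
    rw [innerR_evalCircle_left (hP l) (by fun_prop)]
    refine Finset.sum_eq_zero fun j hj => ?_
    rw [Finset.mem_range] at hj
    rw [innerR_mono_zpow_smul, show (j : ℤ) - (- -c l + -c m) = j - c l + c m by ring,
      h0 l m hlm j (by omega), mul_zero]
  rcases lt_trichotomy l m with h | rfl | h
  · rw [hlt l m h, if_neg h.ne]
  · rw [innerR_zpow_zpow, h1, if_pos rfl]
  · rw [← conjTranspose_innerR, hlt m l h, if_neg h.ne', Matrix.conjTranspose_zero]

namespace IsSzegoSeq

variable {f g : ℕ → (Mat k)[X]} {α : ℕ → Mat k}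

lemma cmvChi_eq (h : IsSzegoSeq μ f g α) (l : ℕ) :
    cmvChi f (fun n => szegoDual n (g n)) l = fun z : Circle =>
      (z : ℂ) ^ (-((l / 2 : ℕ) : ℤ)) • evalCircle (if Even l then g l else f l) z := by
  rw [MatrixCMV.cmvChi_eq, szegoDual_szegoDual (h.pair l).natDegree_snd]

lemma cmvX_eq (h : IsSzegoSeq μ f g α) (l : ℕ) :
    cmvX f (fun n => szegoDual n (g n)) l = fun z : Circle =>
      (z : ℂ) ^ (-(((l + 1) / 2 : ℕ) : ℤ)) • evalCircle (if Even l then f l else g l) z := by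
  rw [MatrixCMV.cmvX_eq, szegoDual_szegoDual (h.pair l).natDegree_snd]

lemma continuous_cmvChi (h : IsSzegoSeq μ f g α) (l : ℕ) :
    Continuous (cmvChi f (fun n => szegoDual n (g n)) l) := by
  rw [h.cmvChi_eq]; fun_prop

lemma continuous_cmvX (h : IsSzegoSeq μ f g α) (l : ℕ) :
    Continuous (cmvX f (fun n => szegoDual n (g n)) l) := by
  rw [h.cmvX_eq]; fun_prop

lemma innerR_mono_fst (h : IsSzegoSeq μ f g α) {n : ℕ} {j : ℤ} (h0 : 0 ≤ j) (hj : j < n) :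
    innerR μ (mono k j) (evalCircle (f n)) = 0 := by
  lift j to ℕ using h0
  exact (h.pair n).orth_fst j (by omega)

lemma innerR_mono_snd (h : IsSzegoSeq μ f g α) {n : ℕ} {j : ℤ} (h0 : 1 ≤ j) (hj : j ≤ n) :
    innerR μ (mono k j) (evalCircle (g n)) = 0 := by
  lift j to ℕ using by omega
  exact (h.pair n).orth_snd j (by omega) (by omega)

/-- For `j ≤ l < m` the exponent `j - ⌊l/2⌋ + ⌊m/2⌋` lies in `1, …, m` if `m` is even and in `0, …,
m - 1` if `m` is odd. These are the orthogonality windows of `g_m` and `f_m`. -/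
lemma innerR_cmvChi (h : IsSzegoSeq μ f g α) (l m : ℕ) :
    innerR μ (cmvChi f (fun n => szegoDual n (g n)) l) (cmvChi f (fun n => szegoDual n (g n)) m) =
      if l = m then 1 else 0 := by
  rw [h.cmvChi_eq, h.cmvChi_eq]
  refine innerR_eq_ite_of_orthogonal (P := fun n => if Even n then g n else f n)
    (fun n => ((n / 2 : ℕ) : ℤ)) (fun n => ?_) (fun n => ?_) (fun l m hlm j hj => ?_) l m <;>
    split_ifs with he
  · exact (h.pair n).natDegree_snd
  · exact (h.pair n).natDegree_fst
  · exact (h.pair n).norm_snd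
  · exact (h.pair n).norm_fst
  · rw [Nat.even_iff] at he
    exact h.innerR_mono_snd (by omega) (by omega)
  · rw [Nat.even_iff] at he
    exact h.innerR_mono_fst (by omega) (by omega)

lemma innerR_cmvX (h : IsSzegoSeq μ f g α) (l m : ℕ) :
    innerR μ (cmvX f (fun n => szegoDual n (g n)) l) (cmvX f (fun n => szegoDual n (g n)) m) =
      if l = m then 1 else 0 := by
  rw [h.cmvX_eq, h.cmvX_eq]
  refine innerR_eq_ite_of_orthogonal (P := fun n => if Even n then f n else g n)
    (fun n => (((n + 1) / 2 : ℕ) : ℤ)) (fun n => ?_) (fun n => ?_) (fun l m hlm j hj => ?_) l m <;>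
    split_ifs with he
  · exact (h.pair n).natDegree_fst
  · exact (h.pair n).natDegree_snd
  · exact (h.pair n).norm_fst
  · exact (h.pair n).norm_snd
  · rw [Nat.even_iff] at he
    exact h.innerR_mono_fst (by omega) (by omega)
  · rw [Nat.even_iff] at he
    exact h.innerR_mono_snd (by omega) (by omega)

lemma conjTranspose_zpow_smul_szegoDual {l a b : ℕ} (hab : a + b = l) {P : (Mat k)[X]}
    (hP : P.natDegree ≤ l) (z : Circle) :
    ((z : ℂ) ^ (-(a : ℤ)) • evalCircle (szegoDual l P) z).conjTranspose =
      (z : ℂ) ^ (-(b : ℤ)) • evalCircle P z := by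
  rw [Matrix.conjTranspose_smul, conjTranspose_evalCircle_szegoDual hP, smul_smul, RCLike.star_def,
    map_zpow₀, ← Circle.coe_inv_eq_conj, Circle.coe_inv, inv_zpow, ← zpow_neg,
    ← zpow_add₀ (Circle.coe_ne_zero z)]
  congr 2
  omega

/-- Adjoints undo the dual up to `z^l`, and `⌊l/2⌋ + ⌊(l+1)/2⌋ = l` makes the remaining power the
one in the alternate family. -/
lemma conjTranspose_cmvChi (h : IsSzegoSeq μ f g α) (l : ℕ) (z : Circle) :
    (cmvChi (fun n => szegoDual n (g n)) f l z).conjTranspose =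
      cmvX f (fun n => szegoDual n (g n)) l z := by
  rw [h.cmvX_eq, MatrixCMV.cmvChi_eq]
  split_ifs
  · exact conjTranspose_zpow_smul_szegoDual (by omega) (h.pair l).natDegree_fst z
  · exact conjTranspose_zpow_smul_szegoDual (by omega) (h.pair l).natDegree_snd z

lemma conjTranspose_cmvX (h : IsSzegoSeq μ f g α) (l : ℕ) (z : Circle) :
    (cmvX (fun n => szegoDual n (g n)) f l z).conjTranspose =
      cmvChi f (fun n => szegoDual n (g n)) l z := by
  rw [h.cmvChi_eq, MatrixCMV.cmvX_eq]
  split_ifs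
  · exact conjTranspose_zpow_smul_szegoDual (by omega) (h.pair l).natDegree_snd z
  · exact conjTranspose_zpow_smul_szegoDual (by omega) (h.pair l).natDegree_fst z

/-- The two columns of `Θ(α_n)` express `z φ^R_n`, `(φ^L_{n+1})^*` through `(φ^L_n)^*`,
`φ^R_{n+1}`. -/
lemma zpow_smul_recursion (h : IsSzegoSeq μ f g α) (n : ℕ) (c : ℤ) (z : Circle) :
    (z : ℂ) ^ (c + 1) • evalCircle (f n) z =
        (z : ℂ) ^ c • evalCircle (g n) z * theta (α n) 0 0 +
          (z : ℂ) ^ c • evalCircle (f (n + 1)) z * theta (α n) 1 0 ∧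
      (z : ℂ) ^ c • evalCircle (g (n + 1)) z =
        (z : ℂ) ^ c • evalCircle (g n) z * theta (α n) 0 1 +
          (z : ℂ) ^ c • evalCircle (f (n + 1)) z * theta (α n) 1 1 := by
  have h1 := evalCircle_X_mul (f n) z
  rw [h.X_mul_fst n, evalCircle_add, evalCircle_mul, evalCircle_mul, evalCircle_C,
    evalCircle_C] at h1
  constructor
  · rw [zpow_add₀ (Circle.coe_ne_zero z), ← smul_smul, ← h1, smul_add, add_comm, Matrix.smul_mul,
      Matrix.smul_mul]
    rfl
  · rw [h.snd_succ_eq, evalCircle_sub, evalCircle_mul, evalCircle_mul, evalCircle_C, evalCircle_C,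
      sub_eq_add_neg, smul_add, ← mul_neg, Matrix.smul_mul, Matrix.smul_mul]
    rfl

lemma isExpansion_blockL (h : IsSzegoSeq μ f g α) :
    IsExpansion (cmvChi f (fun n => szegoDual n (g n)))
      (fun l => mulZ (cmvX f (fun n => szegoDual n (g n)) l)) (blockL α) := by
  refine isExpansion_directSum fun i b z => ?_
  -- The shift `-i` turns `g_{2i}` and `f_{2i+1}` into `χ̃_{2i}` and `χ̃_{2i+1}`; the left sides
  -- become `z x̃_{2i}` and `z x̃_{2i+1}`.
  have hrec := h.zpow_smul_recursion (2 * i) (-(i : ℤ)) z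
  have he : Even (2 * i) := even_two_mul i
  have ho : ¬ Even (2 * i + 1) := by rw [Nat.even_iff]; omega
  rw [h.cmvChi_eq, h.cmvChi_eq, if_pos he, if_neg ho, show 2 * i / 2 = i by omega,
    show (2 * i + 1) / 2 = i by omega]
  have hz : ∀ (c : ℤ) (B : Mat k), (z : ℂ) • (z : ℂ) ^ c • B = (z : ℂ) ^ (c + 1) • B := by
    intro c B
    rw [smul_smul, zpow_add₀ (Circle.coe_ne_zero z), zpow_one, mul_comm]
  fin_cases b
  · simp only [mulZ, Fin.zero_eta, add_zero]
    rw [h.cmvX_eq, if_pos he, show (2 * i + 1) / 2 = i by omega, hz]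
    exact hrec.1
  · simp only [mulZ, Fin.mk_one]
    rw [h.cmvX_eq, if_neg ho, show (2 * i + 1 + 1) / 2 = i + 1 by omega, hz,
      show -((i + 1 : ℕ) : ℤ) + 1 = -(i : ℤ) by omega]
    exact hrec.2

lemma isExpansion_blockM (h : IsSzegoSeq μ f g α) :
    IsExpansion (cmvX f (fun n => szegoDual n (g n)))
      (cmvChi f (fun n => szegoDual n (g n))) (blockM α) := by
  refine IsExpansion.oneDirectSum (fun z => ?_) (isExpansion_directSum fun i b z => ?_)
  · rw [h.cmvChi_eq, h.cmvX_eq, if_pos Even.zero, if_pos Even.zero, h.fst_zero, h.snd_zero]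
  -- The shift `-(i+1)` turns `g_{2i+1}` and `f_{2i+2}` into `x̃_{2i+1}` and `x̃_{2i+2}`; the left
  -- sides are `χ̃_{2i+1}` and `χ̃_{2i+2}`. The corner block comes from `χ̃_0 = x̃_0 = 1`.
  have hrec := h.zpow_smul_recursion (2 * i + 1) (-((i + 1 : ℕ) : ℤ)) z
  have he : Even (2 * i + 1 + 1) := by rw [Nat.even_iff]; omega
  have ho : ¬ Even (2 * i + 1) := by rw [Nat.even_iff]; omega
  rw [h.cmvX_eq, h.cmvX_eq, if_pos he, if_neg ho, show (2 * i + 1 + 1) / 2 = i + 1 by omega,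
    show (2 * i + 1 + 1 + 1) / 2 = i + 1 by omega]
  fin_cases b
  · simp only [Fin.zero_eta, add_zero]
    rw [h.cmvChi_eq, if_neg ho, show (2 * i + 1) / 2 = i by omega,
      show -(i : ℤ) = -((i + 1 : ℕ) : ℤ) + 1 by omega]
    exact hrec.1
  · simp only [Fin.mk_one]
    rw [h.cmvChi_eq, if_pos he, show (2 * i + 1 + 1) / 2 = i + 1 by omega]
    exact hrec.2

end IsSzegoSeq

lemma continuous_mulZ {f : Circle → Mat k} (hf : Continuous f) : Continuous (mulZ f) := by
  have h := continuous_zpow_smul 1 hf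
  simp only [zpow_one] at h
  exact h

end

end MatrixCMV

end

/-! ### Assembly of the theorem. -/

theorem theorem4p2 (k : ℕ) (μ : MatrixCMV.MatrixMeasure k) (hμ : μ.Nontrivial) :
    (∃! φL : ℕ → (MatrixCMV.Mat k)[X], MatrixCMV.IsLeftOPUC μ φL) ∧
    (∃! φR : ℕ → (MatrixCMV.Mat k)[X], MatrixCMV.IsRightOPUC μ φR) ∧
    ∀ φL φR : ℕ → (MatrixCMV.Mat k)[X],
      MatrixCMV.IsLeftOPUC μ φL → MatrixCMV.IsRightOPUC μ φR →
      (∃! α : ℕ → MatrixCMV.Mat k, MatrixCMV.IsVerblunsky φL φR α) ∧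
      ∀ α : ℕ → MatrixCMV.Mat k, MatrixCMV.IsVerblunsky φL φR α →
      ∀ χL xL χR xR : ℕ → Circle → MatrixCMV.Mat k,
      χL = MatrixCMV.cmvChi φL φR → xL = MatrixCMV.cmvX φL φR →
      χR = MatrixCMV.cmvChi φR φL → xR = MatrixCMV.cmvX φR φL →
      -- orthonormality of the left-handed and of the right-handed families
      (∀ l m, MatrixCMV.innerL μ (χL l) (χL m) = if l = m then 1 else 0) ∧
      (∀ l m, MatrixCMV.innerL μ (xL l) (xL m) = if l = m then 1 else 0) ∧
      (∀ l m, MatrixCMV.innerR μ (χR l) (χR m) = if l = m then 1 else 0) ∧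
      (∀ l m, MatrixCMV.innerR μ (xR l) (xR m) = if l = m then 1 else 0) ∧
      -- module spans
      (∀ l, MatrixCMV.InModuleSpan MatrixCMV.cmvExponent (l + 1) (χL l) ∧
        MatrixCMV.InModuleSpan (fun j => -MatrixCMV.cmvExponent j) (l + 1) (xL l) ∧
        MatrixCMV.InModuleSpan MatrixCMV.cmvExponent (l + 1) (χR l) ∧
        MatrixCMV.InModuleSpan (fun j => -MatrixCMV.cmvExponent j) (l + 1) (xR l)) ∧
      -- unitarity of the blocks
      (∀ n, MatrixCMV.thetaFull (α n) ∈ Matrix.unitaryGroup (Fin 2 × Fin k) ℂ) ∧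
      -- the factors and the factorization, right-handed
      MatrixCMV.gramR μ χR (fun l => MatrixCMV.mulZ (xR l)) = MatrixCMV.blockL α ∧
      MatrixCMV.gramR μ xR χR = MatrixCMV.blockM α ∧
      MatrixCMV.IsBlockProduct (MatrixCMV.gramR μ χR (fun l => MatrixCMV.mulZ (χR l)))
        (MatrixCMV.gramR μ χR (fun l => MatrixCMV.mulZ (xR l))) (MatrixCMV.gramR μ xR χR) ∧
      -- the factors and the factorizations, left-handed
      MatrixCMV.gramL μ χL (fun l => MatrixCMV.mulZ (xL l)) = MatrixCMV.blockL α ∧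
      MatrixCMV.gramL μ xL χL = MatrixCMV.blockM α ∧
      MatrixCMV.IsBlockProduct (MatrixCMV.gramL μ xL (fun l => MatrixCMV.mulZ (xL l)))
        (MatrixCMV.gramL μ χL (fun l => MatrixCMV.mulZ (xL l))) (MatrixCMV.gramL μ xL χL) ∧
      MatrixCMV.IsBlockProduct (MatrixCMV.gramL μ χL (fun l => MatrixCMV.mulZ (χL l)))
        (MatrixCMV.gramL μ xL χL) (MatrixCMV.gramL μ χL (fun l => MatrixCMV.mulZ (xL l))) := by
  obtain ⟨f, g, α₀, hs⟩ := MatrixCMV.exists_isSzegoSeq hμ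
  have hR := hs.isRightOPUC
  have hL := hs.isLeftOPUC
  have hV := hs.isVerblunsky
  refine ⟨⟨_, hL, fun φ hφ => hL.unique hμ hφ⟩, ⟨_, hR, fun φ hφ => hR.unique hμ hφ⟩, ?_⟩
  intro φL φR hφL hφR
  -- By uniqueness the given polynomials are those produced by the recursion.
  obtain rfl := hL.unique hμ hφL
  obtain rfl := hR.unique hμ hφR
  refine ⟨⟨α₀, hV, fun β hβ => hs.verblunsky_unique hβ⟩, ?_⟩
  intro α hα χL xL χR xR hχL hxL hχR hxR
  obtain rfl := hs.verblunsky_unique hα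
  have hcχ : ∀ l, Continuous (χR l) := fun l => hχR ▸ hs.continuous_cmvChi l
  have hcx : ∀ l, Continuous (xR l) := fun l => hxR ▸ hs.continuous_cmvX l
  have hoχ : ∀ l m, MatrixCMV.innerR μ (χR l) (χR m) = if l = m then 1 else 0 :=
    fun l m => hχR ▸ hs.innerR_cmvChi l m
  have hox : ∀ l m, MatrixCMV.innerR μ (xR l) (xR m) = if l = m then 1 else 0 :=
    fun l m => hxR ▸ hs.innerR_cmvX l m
  have hdχ : ∀ l z, (χL l z).conjTranspose = xR l z := by
    rw [hχL, hxR]; exact hs.conjTranspose_cmvChi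
  have hdx : ∀ l z, (xL l z).conjTranspose = χR l z := by
    rw [hxL, hχR]; exact hs.conjTranspose_cmvX
  have heL : MatrixCMV.IsExpansion χR (fun l => MatrixCMV.mulZ (xR l)) (MatrixCMV.blockL α) := by
    rw [hχR, hxR]; exact hs.isExpansion_blockL
  have heM : MatrixCMV.IsExpansion xR χR (MatrixCMV.blockM α) := by
    rw [hχR, hxR]; exact hs.isExpansion_blockM
  have hgL := heL.gramR_eq hcχ hoχ
  have hgM := heM.gramR_eq hcx hox
  have hLM : MatrixCMV.IsBlockProduct (MatrixCMV.gramR μ χR fun l => MatrixCMV.mulZ (χR l))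
      (MatrixCMV.gramR μ χR fun l => MatrixCMV.mulZ (xR l)) (MatrixCMV.gramR μ xR χR) := by
    rw [hgM]
    -- The expansion of `χ̃` in `x̃`, multiplied by `z` and paired with `χ̃`, gives `ℒℳ`. Below, the
    -- expansion of `z x̃` in `χ̃`, paired with `x̃`, gives `ℳℒ`.
    exact heM.mulZ.isBlockProduct (fun m => MatrixCMV.continuous_mulZ (hcx m)) hcχ
  have hML : MatrixCMV.IsBlockProduct (MatrixCMV.gramR μ xR fun l => MatrixCMV.mulZ (xR l))
      (MatrixCMV.gramR μ xR χR) (MatrixCMV.gramR μ χR fun l => MatrixCMV.mulZ (xR l)) := by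
    rw [hgL]
    exact heL.isBlockProduct hcχ hcx
  refine ⟨fun l m => ?_, fun l m => ?_, hoχ, hox, fun l => ?_,
    fun n => (hs.isContr n).thetaFull_mem, hgL, hgM, hLM, ?_⟩
  · rw [MatrixCMV.innerL_eq_innerR, funext (hdχ l), funext (hdχ m), hox]
    simp only [eq_comm]
  · rw [MatrixCMV.innerL_eq_innerR, funext (hdx l), funext (hdx m), hoχ]
    simp only [eq_comm]
  · rw [hχL, hxL, hχR, hxR]
    exact ⟨MatrixCMV.inModuleSpan_cmvChi hφL.natDegree_le _ l,
      MatrixCMV.inModuleSpan_cmvX hφL.natDegree_le _ l,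
      MatrixCMV.inModuleSpan_cmvChi hφR.natDegree_le _ l,
      MatrixCMV.inModuleSpan_cmvX hφR.natDegree_le _ l⟩
  -- Under adjoints the left matrix of `z x` becomes the right matrix of `z χ̃`, and that of `z χ`
  -- becomes that of `z x̃`. This is why the order of the factors differs between the two left
  -- products.
  · rw [MatrixCMV.gramL_mulZ_eq_gramR hdχ hdx, MatrixCMV.gramL_eq_gramR hdx hdχ,
      MatrixCMV.gramL_mulZ_eq_gramR hdx hdx, MatrixCMV.gramL_mulZ_eq_gramR hdχ hdχ]
    exact ⟨hgL, hgM, hLM, hML⟩
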